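/- Let $\mathfrak g$ be the N=1 BMS superalgebra, i.e. the complex Lie superalgebra with even basis $L_n, M_n$ $(n\in\mathbb Z)$, $\mathbf c_1,\mathbf c_2$, odd basis $Q_r$ $(r\in\mathbb Z+\frac12)$, and brackets $$[L_m,L_n]=(m-n)L_{m+n}+\tfrac{1}{12}\delta_{m+n,0}(m^3-m)\mathbf c_1,\qquad [L_m,M_n]=(m-n)M_{m+n}+\tfrac1{12}\delta_{m+n,0}(m^3-m)\mathbf c_2,$$ $$[Q_r,Q_s]=2M_{r+s}+\tfrac13\delta_{r+s,0}\left(r^2-\tfrac14\right)\mathbf c_2,\qquad [L_m,Q_r]=\left(\tfrac m2-r\right)Q_{m+r},$$ $$[M_m,M_n]=[M_n,Q_r]=0,\qquad [\mathbf c_1,\mathfrak g]=[\mathbf c_2,\mathfrak g]=0 .$$ Modules are $\mathbb Z_2$-graded, a module is simple if it is nonzero and has no nonzero proper graded submodule, and isomorphisms are parity preserving. A $\mathfrak g$-module $W$ is smooth if for every $w\in W$ one has $L_iw=M_iw=Q_{i-\frac12}w=0$ for all sufficiently large $i$; a module has central charge $(c_1,c_2)$ if $\mathbf c_1,\mathbf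 c_2$ act on it as the scalars $c_1,c_2$. For $q\in\mathbb N=\{0,1,2,\dots\}$ let $$\mathfrak g^{(0,-q)}=\bigoplus_{i\ge 0}\mathbb C L_i\oplus\bigoplus_{j\ge -q}\mathbb C M_j\oplus\bigoplus_{k\ge 1}\mathbb C Q_{k-\frac12}\oplus\mathbb C\mathbf c_1\oplus\mathbb C\mathbf c_2,$$ and for a $\mathfrak g^{(0,-q)}$-module $V$ let $\mathrm{Ind}_q(V)=U(\mathfrak g)\otimes_{U(\mathfrak g^{(0,-q)})}V$. Theorem. Let $c_1,c_2\in\mathbb C$, and let $W$ be a simple smooth $\mathfrak g$-module of central charge $(c_1,c_2)$ on which $M_0+\frac1{24}(n^2-1)\mathbf c_2$ acts injectively for every nonzero integer $n$. Then there are $q\in\mathbb N$ and a simple $\mathfrak g^{(0,-q)}$-module $V$ of central charge $(c_1,c_2)$ such that, for some $t\in\mathbb N$, (a) $M_t$ acts injectively on $V$ if $t>0$, and $M_0+\frac1{24}(n^2-1)\mathbf c_2$ acts injectively on $V$ for every nonzero integer $n$ if $t=0$; (b) $M_iV=0$ for all $i>t$, and $L_jV=0$ for all $j>t+q$; and such that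 $\mathrm{Ind}_q(V)$ is a simple $\mathfrak g$-module and $W\cong\mathrm{Ind}_q(V)$. -/

import Mathlib

open scoped TensorProduct

noncomputable section

/-! ## Complex vector superspaces -/

/-- A complex vector superspace: a complex vector space with a `ℤ/2`-grading
`V = gr 0 ⊕ gr 1` into its even and its odd part. -/
class SuperSpace (V : Type*) [AddCommGroup V] [Module ℂ V] where
  gr : ZMod 2 → Submodule ℂ V
  isCompl : IsCompl (gr 0) (gr 1)

/-- The Koszul sign `(-1)^{ab}`. -/
def superSign (a b : ZMod 2) : ℂ := (-1) ^ (a.val * b.val)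

/-- A subspace `N` is graded if it contains the even and the odd part of each of its elements. -/
def IsGradedSub {V : Type*} [AddCommGroup V] [Module ℂ V] [SuperSpace V]
    (N : Submodule ℂ V) : Prop :=
  ∀ v ∈ N, ∃ v₀ v₁ : V, v₀ ∈ N ∧ v₁ ∈ N ∧
    v₀ ∈ SuperSpace.gr (V := V) 0 ∧ v₁ ∈ SuperSpace.gr (V := V) 1 ∧ v = v₀ + v₁

theorem zmod2_cases (a : ZMod 2) : a = 0 ∨ a = 1 := by
  revert a; decide

theorem SuperSpace.exists_add {V : Type*} [AddCommGroup V] [Module ℂ V] [SuperSpace V] (v : V) :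
    ∃ v₀ v₁ : V, v₀ ∈ SuperSpace.gr (V := V) 0 ∧ v₁ ∈ SuperSpace.gr (V := V) 1 ∧ v = v₀ + v₁ := by
  obtain ⟨y, hy, z, hz, h⟩ := Submodule.mem_sup.1
    ((SuperSpace.isCompl (V := V)).sup_eq_top ▸ Submodule.mem_top : v ∈ _ ⊔ _)
  exact ⟨y, z, hy, hz, h.symm⟩

/-- The parity operator: `+1` on the even part and `-1` on the odd part. -/
def parityOp (V : Type*) [AddCommGroup V] [Module ℂ V] [SuperSpace V] : V →ₗ[ℂ] V :=
  LinearMap.ofIsCompl (SuperSpace.isCompl (V := V))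
    (SuperSpace.gr (V := V) 0).subtype (-(SuperSpace.gr (V := V) 1).subtype)

theorem parityOp_apply {V : Type*} [AddCommGroup V] [Module ℂ V] [SuperSpace V]
    {a : ZMod 2} {v : V} (hv : v ∈ SuperSpace.gr (V := V) a) :
    parityOp V v = (-1 : ℂ) ^ a.val • v := by
  rcases zmod2_cases a with rfl | rfl
  · have := LinearMap.ofIsCompl_apply_left (SuperSpace.isCompl (V := V))
      (φ := (SuperSpace.gr (V := V) 0).subtype)
      (ψ := -(SuperSpace.gr (V := V) 1).subtype) ⟨v, hv⟩
    simpa [parityOp] using this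
  · have := LinearMap.ofIsCompl_apply_right (SuperSpace.isCompl (V := V))
      (φ := (SuperSpace.gr (V := V) 0).subtype)
      (ψ := -(SuperSpace.gr (V := V) 1).subtype) ⟨v, hv⟩
    simpa [parityOp, ZMod.val_one] using this

theorem parityOp_parityOp {V : Type*} [AddCommGroup V] [Module ℂ V] [SuperSpace V] (v : V) :
    parityOp V (parityOp V v) = v := by
  obtain ⟨v₀, v₁, h₀, h₁, rfl⟩ := SuperSpace.exists_add v
  simp [parityOp_apply h₀, parityOp_apply h₁, ZMod.val_one]

/-- The superspace whose even part is the `+1`-eigenspace, and whose odd part is the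
`-1`-eigenspace, of a linear involution. -/
abbrev SuperSpace.ofInvolution {V : Type*} [AddCommGroup V] [Module ℂ V] (σ : V →ₗ[ℂ] V)
    (hσ : ∀ v, σ (σ v) = v) : SuperSpace V where
  gr a := LinearMap.ker (σ - (-1 : ℂ) ^ a.val • LinearMap.id)
  isCompl := by
    constructor
    · rw [Submodule.disjoint_def]
      intro v h0 h1
      have h0' : σ v = v := by simpa [sub_eq_zero] using h0
      have h1' : σ v + v = 0 := by simpa [ZMod.val_one] using h1
      rw [h0', ← two_smul ℂ v] at h1'
      simpa using h1'
    · rw [codisjoint_iff, eq_top_iff]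
      intro v _
      refine Submodule.mem_sup.2 ⟨(1 / 2 : ℂ) • (v + σ v), ?_, (1 / 2 : ℂ) • (v - σ v), ?_, ?_⟩
      · simp [hσ, add_comm]
      · simp [hσ, ZMod.val_one]
      · module

/-! ## Lie superalgebras, subalgebras and modules -/

/-- A complex Lie superalgebra. -/
class LieSuperalgebra (L : Type*) [AddCommGroup L] [Module ℂ L] extends SuperSpace L where
  bracket : L →ₗ[ℂ] L →ₗ[ℂ] L
  bracket_mem : ∀ {a b : ZMod 2} {x y : L}, x ∈ gr a → y ∈ gr b → bracket x y ∈ gr (a + b)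
  bracket_skew : ∀ {a b : ZMod 2} {x y : L}, x ∈ gr a → y ∈ gr b →
    bracket x y = -(superSign a b • bracket y x)
  jacobi : ∀ {a b c : ZMod 2} {x y z : L}, x ∈ gr a → y ∈ gr b → z ∈ gr c →
    bracket x (bracket y z) = bracket (bracket x y) z + superSign a b • bracket y (bracket x z)

/-- A module over a Lie superalgebra: a superspace with an action that respects parities and
satisfies `[x,y]v = x(yv) - (-1)^{|x||y|} y(xv)`. -/
class LieSupermodule (L : Type*) [AddCommGroup L] [Module ℂ L] [LieSuperalgebra L]
    (V : Type*) [AddCommGroup V] [Module ℂ V] [SuperSpace V] where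
  act : L →ₗ[ℂ] Module.End ℂ V
  act_mem : ∀ {a b : ZMod 2} {x : L} {v : V}, x ∈ SuperSpace.gr (V := L) a →
    v ∈ SuperSpace.gr (V := V) b → act x v ∈ SuperSpace.gr (V := V) (a + b)
  act_bracket : ∀ {a b : ZMod 2} {x y : L}, x ∈ SuperSpace.gr (V := L) a →
    y ∈ SuperSpace.gr (V := L) b → ∀ v : V,
    act (LieSuperalgebra.bracket x y) v = act x (act y v) - superSign a b • act y (act x v)

/-- The action of `x` on `V`. -/
abbrev superAct {L : Type*} [AddCommGroup L] [Module ℂ L] [LieSuperalgebra L]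
    (V : Type*) [AddCommGroup V] [Module ℂ V] [SuperSpace V] [LieSupermodule L V] (x : L) :
    Module.End ℂ V :=
  LieSupermodule.act x

/-- A module is simple if it is nonzero and has no graded submodules but `0` and itself. -/
def IsSimpleSupermodule (L : Type*) [AddCommGroup L] [Module ℂ L] [LieSuperalgebra L]
    (V : Type*) [AddCommGroup V] [Module ℂ V] [SuperSpace V] [LieSupermodule L V] : Prop :=
  Nontrivial V ∧ ∀ N : Submodule ℂ V, IsGradedSub N →
    (∀ x : L, ∀ v ∈ N, superAct V x v ∈ N) → N = ⊥ ∨ N = ⊤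

/-- `V` and `W` are isomorphic by an even (i.e. parity preserving) isomorphism of `L`-modules. -/
def SupermoduleIsomorphic (L : Type*) [AddCommGroup L] [Module ℂ L] [LieSuperalgebra L]
    (V : Type*) [AddCommGroup V] [Module ℂ V] [SuperSpace V] [LieSupermodule L V]
    (W : Type*) [AddCommGroup W] [Module ℂ W] [SuperSpace W] [LieSupermodule L W] : Prop :=
  ∃ e : V ≃ₗ[ℂ] W,
    (∀ a : ZMod 2, ∀ v ∈ SuperSpace.gr (V := V) a, e v ∈ SuperSpace.gr (V := W) a) ∧
    ∀ (x : L) (v : V), e (superAct V x v) = superAct W x (e v)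

/-- A (graded) subalgebra of a Lie superalgebra. -/
structure LieSubsuperalgebra (L : Type*) [AddCommGroup L] [Module ℂ L] [LieSuperalgebra L] where
  carrier : Submodule ℂ L
  graded : IsGradedSub carrier
  bracket_closed : ∀ x ∈ carrier, ∀ y ∈ carrier, LieSuperalgebra.bracket x y ∈ carrier

namespace LieSubsuperalgebra

variable {L : Type*} [AddCommGroup L] [Module ℂ L] [LieSuperalgebra L] (H : LieSubsuperalgebra L)

/-- A subalgebra is a Lie superalgebra for the restricted grading and bracket. -/
instance instLieSuperalgebra : LieSuperalgebra H.carrier where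
  gr a := (SuperSpace.gr (V := L) a).comap H.carrier.subtype
  isCompl := by
    constructor
    · rw [Submodule.disjoint_def]
      intro v h0 h1
      exact Subtype.ext ((Submodule.disjoint_def.1 (SuperSpace.isCompl (V := L)).disjoint) _ h0 h1)
    · rw [codisjoint_iff, eq_top_iff]
      rintro ⟨v, hv⟩ _
      obtain ⟨v₀, v₁, m₀, m₁, g₀, g₁, rfl⟩ := H.graded v hv
      exact Submodule.mem_sup.2 ⟨⟨v₀, m₀⟩, g₀, ⟨v₁, m₁⟩, g₁, rfl⟩
  bracket := LinearMap.mk₂ ℂ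
    (fun x y => ⟨LieSuperalgebra.bracket (x : L) (y : L), H.bracket_closed _ x.2 _ y.2⟩)
    (fun _ _ _ => Subtype.ext (by simp)) (fun _ _ _ => Subtype.ext (by simp))
    (fun _ _ _ => Subtype.ext (by simp)) (fun _ _ _ => Subtype.ext (by simp))
  bracket_mem hx hy := LieSuperalgebra.bracket_mem (L := L) hx hy
  bracket_skew hx hy := Subtype.ext (LieSuperalgebra.bracket_skew (L := L) hx hy)
  jacobi hx hy hz := Subtype.ext (LieSuperalgebra.jacobi (L := L) hx hy hz)

end LieSubsuperalgebra

theorem coe_parityOp {L : Type*} [AddCommGroup L] [Module ℂ L] [LieSuperalgebra L]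
    (H : LieSubsuperalgebra L) (h : H.carrier) :
    ((parityOp H.carrier h : H.carrier) : L) = parityOp L (h : L) := by
  obtain ⟨h₀, h₁, g₀, g₁, rfl⟩ := SuperSpace.exists_add h
  have e₀ : parityOp L (h₀ : L) = _ := parityOp_apply (a := 0) g₀
  have e₁ : parityOp L (h₁ : L) = _ := parityOp_apply (a := 1) g₁
  rw [map_add, parityOp_apply g₀, parityOp_apply g₁]
  simp only [Submodule.coe_add, Submodule.coe_smul, map_add]
  rw [e₀, e₁]

theorem parityOp_act {L : Type*} [AddCommGroup L] [Module ℂ L] [LieSuperalgebra L]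
    {V : Type*} [AddCommGroup V] [Module ℂ V] [SuperSpace V] [LieSupermodule L V] (x : L) (v : V) :
    parityOp V (superAct V x v) = superAct V (parityOp L x) (parityOp V v) := by
  obtain ⟨x₀, x₁, g₀, g₁, rfl⟩ := SuperSpace.exists_add x
  obtain ⟨v₀, v₁, k₀, k₁, rfl⟩ := SuperSpace.exists_add v
  have h00 := LieSupermodule.act_mem g₀ k₀
  have h01 := LieSupermodule.act_mem g₀ k₁
  have h10 := LieSupermodule.act_mem g₁ k₀
  have h11 := LieSupermodule.act_mem g₁ k₁
  simp only [superAct, map_add, LinearMap.add_apply, parityOp_apply h00, parityOp_apply h01,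
    parityOp_apply h10, parityOp_apply h11, parityOp_apply g₀, parityOp_apply g₁,
    parityOp_apply k₀, parityOp_apply k₁, map_smul, LinearMap.smul_apply]
  have e : (1 + 1 : ZMod 2) = 0 := by decide
  simp [e, ZMod.val_one]

/-! ## The enveloping algebra and induced modules -/

section Enveloping

variable (L : Type*) [AddCommGroup L] [Module ℂ L] [LieSuperalgebra L]

/-- The relations `xy - (-1)^{|x||y|} yx = [x,y]` of the enveloping algebra. -/
inductive SuperEnvelopingRel : TensorAlgebra ℂ L → TensorAlgebra ℂ L → Prop
  | of {a b : ZMod 2} {x y : L} (hx : x ∈ SuperSpace.gr (V := L) a)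
      (hy : y ∈ SuperSpace.gr (V := L) b) :
      SuperEnvelopingRel (TensorAlgebra.ι ℂ x * TensorAlgebra.ι ℂ y)
        (superSign a b • (TensorAlgebra.ι ℂ y * TensorAlgebra.ι ℂ x)
          + TensorAlgebra.ι ℂ (LieSuperalgebra.bracket x y))

/-- The universal enveloping algebra `U(L)` of a Lie superalgebra. -/
def SuperEnveloping : Type _ := RingQuot (SuperEnvelopingRel L)

instance SuperEnveloping.instRing : Ring (SuperEnveloping L) :=
  inferInstanceAs (Ring (RingQuot (SuperEnvelopingRel L)))

instance SuperEnveloping.instAlgebra : Algebra ℂ (SuperEnveloping L) :=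
  inferInstanceAs (Algebra ℂ (RingQuot (SuperEnvelopingRel L)))

/-- The quotient map from the tensor algebra. -/
def SuperEnveloping.mkHom : TensorAlgebra ℂ L →ₐ[ℂ] SuperEnveloping L :=
  RingQuot.mkAlgHom ℂ (SuperEnvelopingRel L)

variable {L} in
/-- An algebra map out of the tensor algebra that respects the relations descends to `U(L)`. -/
def SuperEnveloping.descend {A : Type*} [Ring A] [Algebra ℂ A] (f : TensorAlgebra ℂ L →ₐ[ℂ] A)
    (hf : ∀ ⦃x y⦄, SuperEnvelopingRel L x y → f x = f y) : SuperEnveloping L →ₐ[ℂ] A :=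
  RingQuot.liftAlgHom ℂ ⟨f, hf⟩

theorem SuperEnveloping.descend_mkHom {A : Type*} [Ring A] [Algebra ℂ A]
    (f : TensorAlgebra ℂ L →ₐ[ℂ] A)
    (hf : ∀ ⦃x y⦄, SuperEnvelopingRel L x y → f x = f y) (t : TensorAlgebra ℂ L) :
    SuperEnveloping.descend f hf (SuperEnveloping.mkHom L t) = f t :=
  RingQuot.liftAlgHom_mkAlgHom_apply (S := ℂ) f hf t

theorem SuperEnveloping.mkHom_surjective : Function.Surjective (SuperEnveloping.mkHom L) :=
  RingQuot.mkAlgHom_surjective ℂ (SuperEnvelopingRel L)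

variable {L} in
/-- The canonical map `L → U(L)`. -/
def superι : L →ₗ[ℂ] SuperEnveloping L :=
  (SuperEnveloping.mkHom L).toLinearMap ∘ₗ TensorAlgebra.ι ℂ

theorem superι_mul {a b : ZMod 2} {x y : L} (hx : x ∈ SuperSpace.gr (V := L) a)
    (hy : y ∈ SuperSpace.gr (V := L) b) :
    superι x * superι y = superSign a b • (superι y * superι x)
      + superι (LieSuperalgebra.bracket x y) := by
  have : SuperEnveloping.mkHom L _ = SuperEnveloping.mkHom L _ :=
    RingQuot.mkAlgHom_rel ℂ (SuperEnvelopingRel.of hx hy)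
  simpa [superι] using this

/-- The parity automorphism of `U(L)`: the algebra map that is the parity operator on `L`. -/
def superParity : SuperEnveloping L →ₐ[ℂ] SuperEnveloping L :=
  SuperEnveloping.descend (TensorAlgebra.lift ℂ (superι ∘ₗ parityOp L)) (by
    rintro _ _ ⟨hx, hy⟩
    rename_i a b x y
    simp only [map_mul, map_add, map_smul, TensorAlgebra.lift_ι_apply, LinearMap.comp_apply,
      parityOp_apply hx, parityOp_apply hy, parityOp_apply (LieSuperalgebra.bracket_mem hx hy)]
    simp only [smul_mul_smul_comm, superι_mul L hx hy, smul_add]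
    have e : (1 + 1 : ZMod 2) = 0 := by decide
    rcases zmod2_cases a with rfl | rfl <;> rcases zmod2_cases b with rfl | rfl <;>
      simp [e, ZMod.val_one])

theorem superParity_ι (x : L) : superParity L (superι x) = superι (parityOp L x) := by
  simp [superParity, superι, SuperEnveloping.descend_mkHom]

theorem superParity_superParity (u : SuperEnveloping L) :
    superParity L (superParity L u) = u := by
  obtain ⟨t, rfl⟩ := SuperEnveloping.mkHom_surjective L u
  have : ((superParity L).comp (superParity L)).comp (SuperEnveloping.mkHom L)
      = SuperEnveloping.mkHom L := by
    apply TensorAlgebra.hom_ext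
    ext x
    change superParity L (superParity L (superι x)) = superι x
    rw [superParity_ι, superParity_ι, parityOp_parityOp]
  exact DFunLike.congr_fun this t

variable {L} (H : LieSubsuperalgebra L)
  (V : Type*) [AddCommGroup V] [Module ℂ V] [SuperSpace V] [LieSupermodule H.carrier V]

/-- The span of the elements `u h ⊗ v - u ⊗ h v` with `u ∈ U(L)`, `h ∈ H`, `v ∈ V`. -/
def inductionRel : Submodule ℂ (SuperEnveloping L ⊗[ℂ] V) :=
  Submodule.span ℂ {z | ∃ (u : SuperEnveloping L) (h : H.carrier) (v : V),
    z = (u * superι (h : L)) ⊗ₜ[ℂ] v - u ⊗ₜ[ℂ] superAct V h v}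

/-- The induced module `Ind V = U(L) ⊗_{U(H)} V`. As `U(H)` is generated by `H`, it is the quotient
of `U(L) ⊗_ℂ V` by the relations `u h ⊗ v = u ⊗ h v` for `h ∈ H`. -/
def InducedModule : Type _ := (SuperEnveloping L ⊗[ℂ] V) ⧸ inductionRel H V

namespace InducedModule

instance instAddCommGroup : AddCommGroup (InducedModule H V) :=
  inferInstanceAs (AddCommGroup ((SuperEnveloping L ⊗[ℂ] V) ⧸ inductionRel H V))

instance instModule : Module ℂ (InducedModule H V) :=
  inferInstanceAs (Module ℂ ((SuperEnveloping L ⊗[ℂ] V) ⧸ inductionRel H V))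

/-- The class of `u ⊗ v` in the induced module, as a linear map. -/
def mk : (SuperEnveloping L ⊗[ℂ] V) →ₗ[ℂ] InducedModule H V := (inductionRel H V).mkQ

theorem mk_surjective : Function.Surjective (mk H V) := Submodule.mkQ_surjective _

variable {H V} in
theorem induction_on {P : InducedModule H V → Prop} (w : InducedModule H V)
    (tmul : ∀ u v, P (mk H V (u ⊗ₜ v))) (zero : P 0) (add : ∀ w w', P w → P w' → P (w + w')) :
    P w := by
  obtain ⟨z, rfl⟩ := mk_surjective H V w
  induction z using TensorProduct.induction_on with
  | zero => simpa using zero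
  | tmul u v => exact tmul u v
  | add z z' h h' => simpa using add _ _ h h'

/-- Left multiplication by an element of `U(L)`. -/
def mulLeft (u : SuperEnveloping L) : InducedModule H V →ₗ[ℂ] InducedModule H V :=
  (inductionRel H V).mapQ (inductionRel H V) (LinearMap.rTensor V (LinearMap.mulLeft ℂ u)) (by
    refine Submodule.span_le.2 ?_
    rintro _ ⟨u', h, v, rfl⟩
    refine Submodule.subset_span ⟨u * u', h, v, ?_⟩
    simp [mul_assoc])

theorem mulLeft_mk (u u' : SuperEnveloping L) (v : V) :
    mulLeft H V u (mk H V (u' ⊗ₜ v)) = mk H V ((u * u') ⊗ₜ v) := rfl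

theorem mulLeft_add (u u' : SuperEnveloping L) :
    mulLeft H V (u + u') = mulLeft H V u + mulLeft H V u' := by
  ext w
  induction w using induction_on with
  | tmul u v => simp [mulLeft_mk, add_mul, TensorProduct.add_tmul]
  | zero => simp
  | add w w' h h' => rw [map_add, map_add, h, h']

theorem mulLeft_smul (c : ℂ) (u : SuperEnveloping L) :
    mulLeft H V (c • u) = c • mulLeft H V u := by
  ext w
  induction w using induction_on with
  | tmul u v =>
    rw [mulLeft_mk, LinearMap.smul_apply, mulLeft_mk, smul_mul_assoc, ← TensorProduct.smul_tmul',
      map_smul]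
  | zero => simp
  | add w w' h h' => rw [map_add, map_add, h, h']

/-- The parity operator `u ⊗ v ↦ (-1)^{|u|+|v|} u ⊗ v`. -/
def parity : InducedModule H V →ₗ[ℂ] InducedModule H V :=
  (inductionRel H V).mapQ (inductionRel H V)
    (TensorProduct.map (superParity L).toLinearMap (parityOp V)) (by
      refine Submodule.span_le.2 ?_
      rintro _ ⟨u, h, v, rfl⟩
      refine Submodule.subset_span ⟨superParity L u, parityOp H.carrier h, parityOp V v, ?_⟩
      rw [coe_parityOp, ← parityOp_act]
      simp [superParity_ι])

theorem parity_mk (u : SuperEnveloping L) (v : V) :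
    parity H V (mk H V (u ⊗ₜ v)) = mk H V (superParity L u ⊗ₜ parityOp V v) := rfl

theorem parity_parity (w : InducedModule H V) : parity H V (parity H V w) = w := by
  induction w using induction_on with
  | tmul u v => simp [parity_mk, superParity_superParity, parityOp_parityOp]
  | zero => simp
  | add w w' h h' => simp [h, h']

/-- The grading of the induced module: `u ⊗ v` has parity `|u| + |v|`. -/
instance instSuperSpace : SuperSpace (InducedModule H V) :=
  SuperSpace.ofInvolution (parity H V) (parity_parity H V)

theorem mem_gr {a : ZMod 2} {w : InducedModule H V} :
    w ∈ SuperSpace.gr (V := InducedModule H V) a ↔ parity H V w = (-1 : ℂ) ^ a.val • w := by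
  change w ∈ LinearMap.ker _ ↔ _
  simp [sub_eq_zero]

theorem parity_mulLeft (u : SuperEnveloping L) (w : InducedModule H V) :
    parity H V (mulLeft H V u w) = mulLeft H V (superParity L u) (parity H V w) := by
  induction w using induction_on with
  | tmul u' v => simp [parity_mk, mulLeft_mk]
  | zero => simp
  | add w w' h h' => simp [h, h']

/-- `L` acts on the induced module by `x (u ⊗ v) = x u ⊗ v`. -/
instance instLieSupermodule : LieSupermodule L (InducedModule H V) where
  act :=
    { toFun := fun x => mulLeft H V (superι x)
      map_add' := fun x y => by rw [map_add, mulLeft_add]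
      map_smul' := fun c x => by rw [map_smul, mulLeft_smul]; rfl }
  act_mem {a b x w} hx hw := by
    rw [mem_gr] at hw ⊢
    change parity H V (mulLeft H V (superι x) w) = _ • mulLeft H V (superι x) w
    rw [parity_mulLeft, superParity_ι, hw, parityOp_apply hx, map_smul, map_smul, mulLeft_smul,
      LinearMap.smul_apply]
    have e : (1 + 1 : ZMod 2) = 0 := by decide
    rcases zmod2_cases a with rfl | rfl <;> rcases zmod2_cases b with rfl | rfl <;>
      simp [e, ZMod.val_one]
  act_bracket {a b x y} hx hy w := by
    change mulLeft H V _ w = mulLeft H V _ (mulLeft H V _ w)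
      - _ • mulLeft H V _ (mulLeft H V _ w)
    induction w using induction_on with
    | tmul u v =>
      simp only [mulLeft_mk, ← map_smul, ← map_sub, TensorProduct.smul_tmul', ← TensorProduct.sub_tmul]
      rw [← mul_assoc, superι_mul L hx hy]
      congr 2
      simp [add_mul, mul_assoc]
    | zero => simp
    | add w w' h h' => simp only [map_add, smul_add, h, h']; abel

end InducedModule

end Enveloping

/-! ## The N=1 BMS superalgebra -/

/-- The standard basis; `Q k` stands for `Q_{k-1/2}`, so that the index of `Q` runs over
`ℤ + 1/2`. -/
inductive BMSIndex : Type
  | L (n : ℤ)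
  | M (n : ℤ)
  | Q (k : ℤ)
  | c₁
  | c₂

/-- The underlying vector space of the N=1 BMS superalgebra: formal finite linear combinations of
the basis. -/
abbrev BMS : Type := BMSIndex →₀ ℂ

namespace BMS

/-- The basis vectors. -/
def e (i : BMSIndex) : BMS := Finsupp.single i (1 : ℂ)

/-- `L_n` -/
def L (n : ℤ) : BMS := e (.L n)
/-- `M_n` -/
def M (n : ℤ) : BMS := e (.M n)
/-- `Q k` is `Q_{k-1/2}` -/
def Q (k : ℤ) : BMS := e (.Q k)
/-- The first central element -/
def c₁ : BMS := e .c₁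
/-- The second central element -/
def c₂ : BMS := e .c₂

/-- The bracket of two basis vectors. With `r = k - 1/2` and `s = l - 1/2`, one has
`r + s = k + l - 1` and `m + r = (m + k) - 1/2`. -/
def br : BMSIndex → BMSIndex → BMS
  | .L m, .L n => ((m : ℂ) - n) • L (m + n) +
      (if m + n = 0 then (1 / 12 : ℂ) * ((m : ℂ) ^ 3 - m) else 0) • c₁
  | .L m, .M n => ((m : ℂ) - n) • M (m + n) +
      (if m + n = 0 then (1 / 12 : ℂ) * ((m : ℂ) ^ 3 - m) else 0) • c₂
  | .M n, .L m => -(((m : ℂ) - n) • M (m + n) +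
      (if m + n = 0 then (1 / 12 : ℂ) * ((m : ℂ) ^ 3 - m) else 0) • c₂)
  | .Q k, .Q l => (2 : ℂ) • M (k + l - 1) +
      (if k + l - 1 = 0 then (1 / 3 : ℂ) * (((k : ℂ) - 1 / 2) ^ 2 - 1 / 4) else 0) • c₂
  | .L m, .Q k => ((m : ℂ) / 2 - ((k : ℂ) - 1 / 2)) • Q (m + k)
  | .Q k, .L m => -(((m : ℂ) / 2 - ((k : ℂ) - 1 / 2)) • Q (m + k))
  | _, _ => 0

/-- The bilinear extension of `br`. -/
def bracketMap : BMS →ₗ[ℂ] BMS →ₗ[ℂ] BMS :=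
  Finsupp.linearCombination ℂ
    (fun i => Finsupp.linearCombination ℂ (fun j => br i j))

theorem bracketMap_e (i j : BMSIndex) : bracketMap (e i) (e j) = br i j := by
  simp [bracketMap, e]

/-- The parity of a basis vector: the `Q`s are odd, all others are even. -/
def par : BMSIndex → ZMod 2
  | .Q _ => 1
  | _ => 0

/-- The span of a set of basis vectors. -/
def spanOf (s : Set BMSIndex) : Submodule ℂ BMS := Submodule.span ℂ (e '' s)

theorem e_mem {s : Set BMSIndex} {i : BMSIndex} (h : i ∈ s) : e i ∈ spanOf s :=
  Submodule.subset_span ⟨i, h, rfl⟩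

theorem spanOf_induction {s : Set BMSIndex} {p : BMS → Prop} {x : BMS} (hx : x ∈ spanOf s)
    (basis : ∀ i ∈ s, p (e i)) (zero : p 0) (add : ∀ x y, p x → p y → p (x + y))
    (smul : ∀ (c : ℂ) x, p x → p (c • x)) : p x := by
  refine Submodule.span_induction ?_ zero (fun x y _ _ => add x y) (fun c x _ => smul c x) hx
  rintro _ ⟨i, hi, rfl⟩
  exact basis i hi

theorem spanOf_eq (s : Set BMSIndex) : spanOf s = Finsupp.supported ℂ ℂ s :=
  (Finsupp.supported_eq_span_single ℂ s).symm

theorem br_mem (i j : BMSIndex) : br i j ∈ spanOf {k | par k = par i + par j} := by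
  have e2 : (1 + 1 : ZMod 2) = 0 := by decide
  have key : ∀ (k : BMSIndex), par k = par i + par j →
      e k ∈ spanOf {k | par k = par i + par j} := fun k hk => e_mem hk
  cases i <;> cases j <;> simp only [br, zero_mem, neg_mem_iff] <;>
    first
    | exact add_mem (Submodule.smul_mem _ _ (key _ (by simp [par, e2])))
        (Submodule.smul_mem _ _ (key _ (by simp [par, e2])))
    | exact Submodule.smul_mem _ _ (key _ (by simp [par]))

theorem br_skew (i j : BMSIndex) : br i j = -(superSign (par i) (par j) • br j i) := by
  rcases i with a | a | a | _ | _ <;> rcases j with b | b | b | _ | _ <;>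
    simp [br, par, superSign, ZMod.val_one, -ite_smul]
  · rw [add_comm b a]
    by_cases h : a + b = 0
    · obtain rfl : b = -a := by omega
      simp only [h, if_true]
      push_cast
      module
    · simp only [h, if_false]
      module
  · rw [add_comm b a]
    by_cases h : a + b - 1 = 0
    · obtain rfl : b = 1 - a := by omega
      simp only [h, if_true]
      push_cast
      module
    · simp only [h, if_false]
      module

theorem br_jacobi (i j k : BMSIndex) :
    bracketMap (e i) (br j k) =
      bracketMap (br i j) (e k) + superSign (par i) (par j) • bracketMap (e j) (br i k) := by
  rcases i with a | a | a | _ | _ <;> rcases j with b | b | b | _ | _ <;>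
    rcases k with c | c | c | _ | _ <;>
    simp [br, par, superSign, L, M, Q, c₁, c₂, bracketMap_e, ZMod.val_one, -ite_smul]
  all_goals first
    | (by_cases h : a + b + c = 0
       · obtain rfl : c = -a - b := by omega
         repeat rw [if_pos (by ring)]
         ring_nf
         match_scalars <;> ring
       · repeat rw [if_neg (by omega)]
         ring_nf
         match_scalars <;> ring)
    | (by_cases h : a + b + c - 1 = 0
       · obtain rfl : c = 1 - a - b := by omega
         repeat rw [if_pos (by ring)]
         ring_nf
         match_scalars <;> ring
       · repeat rw [if_neg (by omega)]
         ring_nf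
         match_scalars <;> ring)

theorem gr_induction {a : ZMod 2} {p : BMS → Prop} {x : BMS} (hx : x ∈ spanOf {i | par i = a})
    (basis : ∀ i, par i = a → p (e i)) (zero : p 0) (add : ∀ x y, p x → p y → p (x + y))
    (smul : ∀ (c : ℂ) x, p x → p (c • x)) : p x :=
  spanOf_induction hx basis zero add smul

/-- The N=1 BMS superalgebra. -/
instance instLieSuperalgebra : LieSuperalgebra BMS where
  gr a := spanOf {i | par i = a}
  isCompl := by
    rw [spanOf_eq, spanOf_eq]
    constructor
    · refine Finsupp.disjoint_supported_supported (Set.disjoint_left.2 fun i h0 h1 => ?_)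
      have h0' : par i = 0 := h0
      have h1' : par i = 1 := h1
      exact absurd (h0'.symm.trans h1') (by decide)
    · rw [codisjoint_iff, ← Finsupp.supported_union, eq_top_iff]
      intro x _ i _
      exact zmod2_cases (par i)
  bracket := bracketMap
  bracket_mem {a b x y} hx hy := by
    refine gr_induction (p := fun x => bracketMap x y ∈ spanOf {i | par i = a + b}) hx ?_ (by simp) (fun x x' h h' => by simpa using add_mem h h')
      (fun c x h => by simpa using Submodule.smul_mem _ c h)
    rintro i rfl
    refine gr_induction (p := fun y => bracketMap (e i) y ∈ spanOf {k | par k = par i + b}) hy ?_ (by simp) (fun x x' h h' => by simpa using add_mem h h')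
      (fun c x h => by simpa using Submodule.smul_mem _ c h)
    rintro j rfl
    rw [bracketMap_e]
    exact br_mem i j
  bracket_skew {a b x y} hx hy := by
    refine gr_induction (p := fun x => bracketMap x y = -(superSign a b • bracketMap y x)) hx ?_ (by simp)
      (fun x x' h h' => by simp only [map_add, LinearMap.add_apply, h, h', smul_add]; abel)
      (fun c x h => by
        simp only [map_smul, LinearMap.smul_apply, h, smul_neg, smul_comm c])
    rintro i rfl
    refine gr_induction (p := fun y => bracketMap (e i) y = -(superSign (par i) b • bracketMap y (e i))) hy ?_ (by simp)
      (fun x x' h h' => by simp only [map_add, LinearMap.add_apply, h, h', smul_add]; abel)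
      (fun c x h => by
        simp only [map_smul, LinearMap.smul_apply, h, smul_neg, smul_comm c])
    rintro j rfl
    rw [bracketMap_e, bracketMap_e]
    exact br_skew i j
  jacobi {a b c x y z} hx hy hz := by
    refine gr_induction (p := fun x => bracketMap x (bracketMap y z) =
      bracketMap (bracketMap x y) z + superSign a b • bracketMap y (bracketMap x z)) hx ?_ (by simp)
      (fun x x' h h' => by simp only [map_add, LinearMap.add_apply, h, h', smul_add]; abel)
      (fun c x h => by simp only [map_smul, LinearMap.smul_apply, h, smul_add, smul_comm c])
    rintro i rfl
    refine gr_induction (p := fun y => bracketMap (e i) (bracketMap y z) = bracketMap (bracketMap (e i) y) z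
      + superSign (par i) b • bracketMap y (bracketMap (e i) z)) hy ?_ (by simp)
      (fun x x' h h' => by simp only [map_add, LinearMap.add_apply, h, h', smul_add]; abel)
      (fun c x h => by simp only [map_smul, LinearMap.smul_apply, h, smul_add, smul_comm c])
    rintro j rfl
    refine gr_induction (p := fun z => bracketMap (e i) (bracketMap (e j) z) = bracketMap (bracketMap (e i) (e j)) z
      + superSign (par i) (par j) • bracketMap (e j) (bracketMap (e i) z)) hz ?_ (by simp)
      (fun x x' h h' => by simp only [map_add, h, h', smul_add]; abel)
      (fun c x h => by simp only [map_smul, h, smul_add, smul_comm c])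
    rintro k rfl
    rw [bracketMap_e, bracketMap_e, bracketMap_e]
    exact br_jacobi i j k

/-- The basis vectors `L_i` (`i ≥ 0`), `M_j` (`j ≥ -q`), `Q_{k-1/2}` (`k ≥ 1`), `𝐜₁`, `𝐜₂`. -/
def subIndex (q : ℕ) : Set BMSIndex := {i | match i with
  | .L n => 0 ≤ n
  | .M n => -(q : ℤ) ≤ n
  | .Q k => 1 ≤ k
  | .c₁ => True
  | .c₂ => True}

theorem br_mem_sub (q : ℕ) {i j : BMSIndex} (hi : i ∈ subIndex q) (hj : j ∈ subIndex q) :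
    br i j ∈ spanOf (subIndex q) := by
  have key : ∀ k : BMSIndex, k ∈ subIndex q → e k ∈ spanOf (subIndex q) := fun k hk => e_mem hk
  cases i <;> cases j <;> simp only [br, zero_mem, neg_mem_iff] <;>
    simp only [subIndex, Set.mem_ofPred_eq] at hi hj <;>
    first
    | exact add_mem (Submodule.smul_mem _ _ (key _ (by simp only [subIndex, Set.mem_ofPred_eq]; omega)))
        (Submodule.smul_mem _ _ (key _ (by simp only [subIndex, Set.mem_ofPred_eq])))
    | exact Submodule.smul_mem _ _ (key _ (by simp only [subIndex, Set.mem_ofPred_eq]; omega))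

/-- The subalgebra `𝔤^{(0,-q)}` spanned by `L_i` (`i ≥ 0`), `M_j` (`j ≥ -q`),
`Q_{k-1/2}` (`k ≥ 1`), `𝐜₁` and `𝐜₂`. -/
def sub (q : ℕ) : LieSubsuperalgebra BMS where
  carrier := spanOf (subIndex q)
  graded x hx := by
    refine spanOf_induction (p := fun x => ∃ x₀ x₁ : BMS, x₀ ∈ spanOf (subIndex q) ∧
      x₁ ∈ spanOf (subIndex q) ∧ x₀ ∈ spanOf {i | par i = 0} ∧ x₁ ∈ spanOf {i | par i = 1} ∧
      x = x₀ + x₁) hx ?_ ⟨0, 0, by simp⟩ ?_ ?_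
    · intro i hi
      rcases zmod2_cases (par i) with h | h
      · exact ⟨e i, 0, e_mem hi, zero_mem _, e_mem h, zero_mem _, by simp⟩
      · exact ⟨0, e i, zero_mem _, e_mem hi, zero_mem _, e_mem h, by simp⟩
    · rintro _ _ ⟨x₀, x₁, a, b, c, d, rfl⟩ ⟨y₀, y₁, a', b', c', d', rfl⟩
      exact ⟨x₀ + y₀, x₁ + y₁, add_mem a a', add_mem b b', add_mem c c', add_mem d d', by abel⟩
    · rintro t _ ⟨x₀, x₁, a, b, c, d, rfl⟩
      exact ⟨t • x₀, t • x₁, Submodule.smul_mem _ _ a, Submodule.smul_mem _ _ b,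
        Submodule.smul_mem _ _ c, Submodule.smul_mem _ _ d, by simp⟩
  bracket_closed x hx y hy := by
    change bracketMap x y ∈ _
    refine spanOf_induction (p := fun x => bracketMap x y ∈ spanOf (subIndex q)) hx ?_ (by simp)
      (fun x x' h h' => by simpa using add_mem h h')
      (fun c x h => by simpa using Submodule.smul_mem _ c h)
    intro i hi
    refine spanOf_induction (p := fun y => bracketMap (e i) y ∈ spanOf (subIndex q)) hy ?_
      (by simp) (fun x x' h h' => by simpa using add_mem h h')
      (fun c x h => by simpa using Submodule.smul_mem _ c h)
    intro j hj
    rw [bracketMap_e]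
    exact br_mem_sub q hi hj

/-- `L_i`, `i ≥ 0`, as an element of `𝔤^{(0,-q)}` -/
def subL (q i : ℕ) : (sub q).carrier :=
  ⟨L i, e_mem (by simp [subIndex])⟩

/-- `M_i`, `i ≥ 0`, as an element of `𝔤^{(0,-q)}` -/
def subM (q i : ℕ) : (sub q).carrier :=
  ⟨M i, e_mem (by simp only [subIndex, Set.mem_ofPred_eq]; omega)⟩

/-- `𝐜₁` as an element of `𝔤^{(0,-q)}` -/
def subc₁ (q : ℕ) : (sub q).carrier := ⟨c₁, e_mem (by simp [subIndex])⟩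

/-- `𝐜₂` as an element of `𝔤^{(0,-q)}` -/
def subc₂ (q : ℕ) : (sub q).carrier := ⟨c₂, e_mem (by simp [subIndex])⟩

/-! ## The classes of modules -/

section Modules

variable (W : Type*) [AddCommGroup W] [Module ℂ W] [SuperSpace W] [LieSupermodule BMS W]

/-- Every vector is annihilated by `L_i`, `M_i`, `Q_{i-1/2}` for all sufficiently large `i`. -/
def IsSmooth : Prop :=
  ∀ w : W, ∃ N : ℤ, ∀ i : ℤ, N ≤ i →
    superAct W (L i) w = 0 ∧ superAct W (M i) w = 0 ∧ superAct W (Q i) w = 0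

/-- `𝐜₁`, `𝐜₂` act as the scalars `z₁`, `z₂`. -/
def HasCentralCharge (z₁ z₂ : ℂ) : Prop :=
  ∀ w : W, superAct W c₁ w = z₁ • w ∧ superAct W c₂ w = z₂ • w

end Modules

section SubModules

variable (q : ℕ) (V : Type*) [AddCommGroup V] [Module ℂ V] [SuperSpace V]
  [LieSupermodule (sub q).carrier V]

/-- `𝐜₁`, `𝐜₂` act on the `𝔤^{(0,-q)}`-module `V` as the scalars `z₁`, `z₂`. -/
def HasCentralChargeSub (z₁ z₂ : ℂ) : Prop :=
  ∀ v : V, superAct V (subc₁ q) v = z₁ • v ∧ superAct V (subc₂ q) v = z₂ • v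

/-- `M_t` is injective on `V` if `t > 0`, and `M_0 + (n² - 1)/24 𝐜₂` is injective on `V` for all
nonzero integers `n` if `t = 0`. -/
def ConditionA (t : ℕ) : Prop :=
  (0 < t → Function.Injective (superAct V (subM q t))) ∧
  (t = 0 → ∀ n : ℤ, n ≠ 0 →
    Function.Injective (superAct V (subM q 0 + ((1 / 24 : ℂ) * ((n : ℂ) ^ 2 - 1)) • subc₂ q)))

/-- `M_i V = 0` for all `i > t` and `L_j V = 0` for all `j > t + q`. -/
def ConditionB (t : ℕ) : Prop :=
  (∀ i : ℕ, t < i → ∀ v : V, superAct V (subM q i) v = 0) ∧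
  (∀ j : ℕ, t + q < j → ∀ v : V, superAct V (subL q j) v = 0)

/-- `Ind_q V`, the `𝔤`-module induced from the `𝔤^{(0,-q)}`-module `V`. -/
abbrev Ind : Type _ := InducedModule (sub q) V

end SubModules

end BMS

end

universe u

/-! Let `t` be minimal such that some nonzero vector of `W` is killed by all `M_i` with `i > t`. On
the vectors so killed, `M_t` is injective: by minimality if `t > 0`, while for `t = 0` the
hypothesis supplies the injectivity of `M_0 + (n² - 1)/24 𝐜₂`. The `Q_r` with `r > t` anticommute up
to such `M_i`, so applying some of them leads to a nonzero vector that they kill too, and smoothness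
then gives a `q` such that the `L_i` with `i > t + q` also kill it. The required `V` is the space of
all vectors killed by these operators (`vacuum`); it is graded and stable under `𝔤^{(0,-q)}`.

The core is `bijective_lift`: for every nonzero graded `𝔤^{(0,-q)}`-submodule `N` of `V`, the map
`Ind N → W` is bijective, and `V ≤ N`. The case `N = V` gives `W ≅ Ind V`, and general `N` gives the
simplicity of `V`. Surjectivity holds because `W` is simple. The rest follows from an analysis of
`Ind N`, which is spanned by words in negative `L`s, then `Q`s, then `M`s, applied to `N`
(`wordSpan_eq_top`). The annihilators strip off one layer each: `M_k` with `k > t` detects the `L`s,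
`Q_r` with `r > t` the `Q`s, and `L_k` with `k > t + q` the `M`s. Hence a submodule that avoids `N`,
such as the kernel, is zero, and every vector killed by all annihilators lies in `N`.

Each layer uses the same device, `IsLowering.mem_of_annihilated`. Words are treated as polynomials
in the letters `x j`, on which `y i` acts as the derivation `∑ p i j ∂_j` up to errors. The matrix
`p` is triangular and its diagonal is a nonzero multiple of `M_t`, or of some `M_0 + (n² - 1)/24
𝐜₂`. If all `y i u` vanish, then so do the partials, and Euler's formula `n u ≈ ∑ x j ∂_j u` shows
that `u` is a combination of shorter words. Only the spanning property of words is used, never their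
linear independence, so no PBW theorem is needed. -/

/-! ## The filtration by word length -/

section WordFiltration

variable {X : Type*} [AddCommGroup X] [Module ℂ X]

/-- The span of the words of length less than `n` in the operators `x j`, applied to `D`. -/
def wordFilt (D : Submodule ℂ X) (x : ℕ → Module.End ℂ X) : ℕ → Submodule ℂ X
  | 0 => ⊥
  | n + 1 => D ⊔ ⨆ j, (wordFilt D x n).map (x j)

/-- The smallest subspace that contains `D` and is stable under the operators `x j`. -/
def wordSpan (D : Submodule ℂ X) (x : ℕ → Module.End ℂ X) : Submodule ℂ X :=
  ⨆ n, wordFilt D x n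

variable {D : Submodule ℂ X} {x : ℕ → Module.End ℂ X}

theorem wordFilt_one : wordFilt D x 1 = D := by
  simp [wordFilt]

theorem le_wordFilt_succ (n : ℕ) : D ≤ wordFilt D x (n + 1) := le_sup_left

theorem map_mem_wordFilt {n : ℕ} {u : X} (hu : u ∈ wordFilt D x n) (j : ℕ) :
    x j u ∈ wordFilt D x (n + 1) :=
  (le_sup_right : _ ≤ D ⊔ ⨆ j, (wordFilt D x n).map (x j))
    (Submodule.mem_iSup_of_mem j (Submodule.mem_map_of_mem hu))

theorem wordFilt_succ_le {n : ℕ} {S : Submodule ℂ X} (hD : D ≤ S)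
    (hx : ∀ j, ∀ u ∈ wordFilt D x n, x j u ∈ S) : wordFilt D x (n + 1) ≤ S :=
  sup_le hD (iSup_le fun j => Submodule.map_le_iff_le_comap.2 (hx j))

theorem wordFilt_le_succ (n : ℕ) : wordFilt D x n ≤ wordFilt D x (n + 1) := by
  induction n with
  | zero => exact bot_le
  | succ n ih =>
    exact wordFilt_succ_le (le_wordFilt_succ _) fun j u hu => map_mem_wordFilt (ih hu) j

theorem wordFilt_mono : Monotone (wordFilt D x) := monotone_nat_of_le_succ wordFilt_le_succ

theorem mem_wordSpan {u : X} : u ∈ wordSpan D x ↔ ∃ n, u ∈ wordFilt D x n :=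
  Submodule.mem_iSup_of_directed _ wordFilt_mono.directed_le

theorem le_wordSpan : D ≤ wordSpan D x := fun _ hu =>
  mem_wordSpan.2 ⟨1, le_wordFilt_succ 0 hu⟩

theorem map_mem_wordSpan {u : X} (hu : u ∈ wordSpan D x) (j : ℕ) : x j u ∈ wordSpan D x := by
  obtain ⟨n, hn⟩ := mem_wordSpan.1 hu
  exact mem_wordSpan.2 ⟨n + 1, map_mem_wordFilt hn j⟩

theorem wordSpan_le {S : Submodule ℂ X} (hD : D ≤ S)
    (hx : ∀ j, ∀ u ∈ wordSpan D x, u ∈ S → x j u ∈ S) : wordSpan D x ≤ S := by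
  refine iSup_le fun n => ?_
  induction n with
  | zero => exact bot_le
  | succ n ih =>
    exact wordFilt_succ_le hD fun j u hu => hx j u (mem_wordSpan.2 ⟨n, hu⟩) (ih hu)

theorem lsum_sub_lsum_mem {f g : ℕ → Module.End ℂ X} {w : ℕ →₀ X} {S : Submodule ℂ X}
    (h : ∀ j, f j (w j) - g j (w j) ∈ S) : Finsupp.lsum ℂ f w - Finsupp.lsum ℂ g w ∈ S := by
  rw [Finsupp.lsum_apply, Finsupp.lsum_apply, Finsupp.sum, Finsupp.sum, ← Finset.sum_sub_distrib]
  exact Submodule.sum_mem _ fun j _ => h j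

theorem lsum_mem {f : ℕ → Module.End ℂ X} {w : ℕ →₀ X} {S : Submodule ℂ X}
    (h : ∀ j, f j (w j) ∈ S) : Finsupp.lsum ℂ f w ∈ S := by
  rw [Finsupp.lsum_apply, Finsupp.sum]
  exact Submodule.sum_mem _ fun j _ => h j

theorem mem_of_lsum_mem {f : ℕ → Module.End ℂ X} {w : ℕ →₀ X} {S : Submodule ℂ X} (k : ℕ)
    (h : Finsupp.lsum ℂ f w ∈ S) (hk : ∀ j, j ≠ k → f j (w j) ∈ S) : f k (w k) ∈ S := by
  rw [Finsupp.lsum_apply, Finsupp.sum] at h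
  by_cases hw : k ∈ w.support
  · rw [← Finset.add_sum_erase _ _ hw] at h
    exact (Submodule.add_mem_iff_left _ (Submodule.sum_mem _ fun j hj =>
      hk j (Finset.ne_of_mem_erase hj))).1 h
  · simp [Finsupp.notMem_support_iff.1 hw]

theorem lsum_mapRange (f : ℕ → Module.End ℂ X) (g : Module.End ℂ X) (w : ℕ →₀ X) :
    Finsupp.lsum ℂ f (Finsupp.mapRange.linearMap g w) = Finsupp.lsum ℂ (fun j => f j * g) w := by
  simp [Finsupp.sum_mapRange_index]
  rfl

/-! ### Creation and annihilation operators -/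

/-- Creation operators `x j` and annihilation operators `y i` on words over `D`. Their
(anti)commutators `p i j` are, up to the error spaces `N n`, scalars for the word filtration. -/
structure IsLowering (D : Submodule ℂ X) (x y : ℕ → Module.End ℂ X)
    (p : ℕ → ℕ → Module.End ℂ X) (s : ℂ) (N : ℕ → Submodule ℂ X) : Prop where
  sign : s * s = 1
  comm : ∀ n j a, ∀ u ∈ wordFilt D x n, x j (x a u) - s • x a (x j u) ∈ wordFilt D x (n + 1)
  bracket : ∀ i j u, y i (x j u) = s • x j (y i u) + p i j u
  annihilates : ∀ i, ∀ u ∈ D, y i u = 0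
  map_err : ∀ n a, ∀ u ∈ N n, x a u ∈ N (n + 1)
  almost_comm : ∀ n i j a, ∀ u ∈ wordFilt D x n, x a (p i j u) - p i j (x a u) ∈ N (n + 1)

namespace IsLowering

variable {y : ℕ → Module.End ℂ X} {p : ℕ → ℕ → Module.End ℂ X} {s : ℂ} {N : ℕ → Submodule ℂ X}

/-- A word has partial derivatives `w j` with respect to the letters `x j`: Euler's formula holds
up to shorter words, and `y i` acts as the derivation with values `p i j`. -/
theorem exists_partials (h : IsLowering D x y p s N) (n : ℕ) :
    ∀ u ∈ wordFilt D x (n + 1), ∃ w : ℕ →₀ X, (∀ j, w j ∈ wordFilt D x n) ∧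
      (n : ℂ) • u - Finsupp.lsum ℂ x w ∈ wordFilt D x n ∧
      ∀ i, y i u - Finsupp.lsum ℂ (p i) w ∈ N n := by
  suffices H : ∃ S : Submodule ℂ X, (S : Set X) = {u | ∃ w : ℕ →₀ X, (∀ j, w j ∈ wordFilt D x n) ∧
      (n : ℂ) • u - Finsupp.lsum ℂ x w ∈ wordFilt D x n ∧
      ∀ i, y i u - Finsupp.lsum ℂ (p i) w ∈ N n} ∧ wordFilt D x (n + 1) ≤ S by
    obtain ⟨S, hS, hle⟩ := H
    intro u hu
    exact (Set.ext_iff.1 hS u).1 (hle hu)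
  refine ⟨{ carrier := _, add_mem' := ?_, zero_mem' := ?_, smul_mem' := ?_ }, rfl, ?_⟩
  · rintro u u' ⟨w, h1, h2, h3⟩ ⟨w', h1', h2', h3'⟩
    refine ⟨w + w', fun j => add_mem (h1 j) (h1' j), ?_, fun i => ?_⟩
    · convert add_mem h2 h2' using 1
      rw [map_add]; module
    · convert add_mem (h3 i) (h3' i) using 1
      rw [map_add, map_add]; module
  · exact ⟨0, by simp⟩
  · rintro c u ⟨w, h1, h2, h3⟩
    refine ⟨c • w, fun j => Submodule.smul_mem _ _ (h1 j), ?_, fun i => ?_⟩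
    · convert Submodule.smul_mem _ c h2 using 1
      rw [map_smul]; module
    · convert Submodule.smul_mem _ c (h3 i) using 1
      rw [map_smul, map_smul]; module
  · induction n with
    | zero =>
      rw [wordFilt_one]
      intro u hu
      exact ⟨0, by simp, by simp, fun i => by simp [h.annihilates i u hu]⟩
    | succ n ih =>
      refine wordFilt_succ_le ?_ ?_
      · intro u hu
        refine ⟨0, by simp, ?_, fun i => by simp [h.annihilates i u hu]⟩
        simpa using Submodule.smul_mem _ _ (le_wordFilt_succ n hu)
      · intro a v hv
        obtain ⟨w, h1, h2, h3⟩ := ih hv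
        -- The Leibniz rule: `∂_j (x_a v) = δ_{ja} v + s x_a ∂_j v`. The new letter raises the Euler
        -- degree by one, and `s * s = 1` cancels the sign that arises when `x j` moves past `x a`.
        refine ⟨Finsupp.single a v + s • Finsupp.mapRange.linearMap (x a) w, fun j => ?_, ?_,
          fun i => ?_⟩
        · rw [Finsupp.add_apply, Finsupp.smul_apply]
          refine add_mem ?_ (Submodule.smul_mem _ _ ?_)
          · rw [Finsupp.single_apply]
            split_ifs
            exacts [hv, zero_mem _]
          · simpa using map_mem_wordFilt (h1 j) a
        · have e1 := map_mem_wordFilt h2 a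
          have e2 : Finsupp.lsum ℂ (fun j => x j * x a) w - Finsupp.lsum ℂ (fun j => s • (x a * x j)) w
              ∈ wordFilt D x (n + 1) := lsum_sub_lsum_mem fun j => by
            simpa using h.comm n j a _ (h1 j)
          have e3 : Finsupp.lsum ℂ (fun j => s • (x a * x j)) w = s • x a (Finsupp.lsum ℂ x w) := by
            simp [Finsupp.sum, Finset.smul_sum]
          rw [e3] at e2
          convert sub_mem e1 (Submodule.smul_mem _ s e2) using 1
          rw [map_add, map_smul, lsum_mapRange, Finsupp.lsum_single, map_sub, map_smul, smul_sub,
            smul_smul, h.sign]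
          push_cast
          module
        · have e1 := h.map_err n a _ (h3 i)
          have e2 : Finsupp.lsum ℂ (fun j => x a * p i j) w - Finsupp.lsum ℂ (fun j => p i j * x a) w
              ∈ N (n + 1) := lsum_sub_lsum_mem fun j => by
            simpa using h.almost_comm n i j a _ (h1 j)
          have e3 : Finsupp.lsum ℂ (fun j => x a * p i j) w = x a (Finsupp.lsum ℂ (p i) w) := by
            simp [Finsupp.sum]
          rw [e3] at e2
          convert Submodule.smul_mem _ s (add_mem e1 e2) using 1
          rw [map_add, map_smul, lsum_mapRange, Finsupp.lsum_single, map_sub, h.bracket]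
          module

/-- If the `p i j` are triangular up to the error spaces, with nondegenerate diagonal, then a word
that is annihilated by all `y i` up to an error is a combination of shorter words. -/
theorem mem_of_annihilated (h : IsLowering D x y p s N) {n : ℕ} (hn : n ≠ 0) {P : Submodule ℂ X}
    (hP : ∀ j, ∀ w ∈ P, x j w ∈ wordFilt D x n) (hPN : ∀ i j, ∀ w ∈ P, p i j w ∈ N n)
    (hlt : ∀ i j, j < i → ∀ w ∈ wordFilt D x n, p i j w ∈ N n)
    (hdiag : ∀ i, ∀ w ∈ wordFilt D x n, p i i w ∈ N n → w ∈ P)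
    {u : X} (hu : u ∈ wordFilt D x (n + 1)) (hy : ∀ i, y i u ∈ N n) : u ∈ wordFilt D x n := by
  obtain ⟨w, h1, h2, h3⟩ := h.exists_partials n u hu
  have h4 : ∀ i, Finsupp.lsum ℂ (p i) w ∈ N n := fun i =>
    by simpa using sub_mem (hy i) (h3 i)
  obtain ⟨B, hB⟩ : ∃ B, ∀ j, B ≤ j → w j = 0 := by
    refine ⟨w.support.sup id + 1, fun j hj => ?_⟩
    by_contra hne
    have := Finset.le_sup (f := id) (Finsupp.mem_support_iff.2 hne)
    simp only [id] at this
    omega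
  -- Back substitution from the largest letter downwards: in the `j`-th equation the terms with `k <
  -- j` vanish by triangularity, and those with `k > j` are already known to be negligible.
  have key : ∀ m j, B ≤ j + m → w j ∈ P := by
    intro m
    induction m with
    | zero => intro j hj; rw [hB j hj]; exact zero_mem _
    | succ m ih =>
      intro j hj
      refine hdiag j _ (h1 j) (mem_of_lsum_mem j (h4 j) fun k hk => ?_)
      rcases lt_or_gt_of_ne hk with hk | hk
      · exact hlt _ _ hk _ (h1 k)
      · exact hPN _ _ _ (ih k (by omega))
  have h5 : Finsupp.lsum ℂ x w ∈ wordFilt D x n :=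
    lsum_mem fun j => hP j _ (key B j (by omega))
  have h6 : (n : ℂ) • u ∈ wordFilt D x n := by simpa using add_mem h2 h5
  -- Euler's formula can be divided by the degree, as the characteristic is zero.
  exact (Submodule.smul_mem_iff _ (Nat.cast_ne_zero.2 hn)).1 h6

/-- The case of a single error space `K`, when the diagonal `p i i` is injective modulo `K`. -/
theorem mem_of_annihilated_mod {K : Submodule ℂ X} (h : IsLowering D x y p s fun _ => K)
    (hyK : ∀ i, ∀ u ∈ K, y i u ∈ K) (hDK : ∀ u ∈ D, u ∈ K → u = 0)
    (hlt : ∀ i j, j < i → ∀ w ∈ wordSpan D x, p i j w ∈ K)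
    (hdiag : ∀ i, ∀ w ∈ wordSpan D x, p i i w ∈ K → w ∈ K)
    {u : X} (hu : u ∈ wordSpan D x) (hy : ∀ i, y i u ∈ K) : u ∈ D := by
  obtain ⟨n, hn⟩ := mem_wordSpan.1 hu
  clear hu
  induction n generalizing u with
  | zero => rw [(Submodule.mem_bot ℂ).1 hn]; exact zero_mem _
  | succ n ih =>
    rcases eq_or_ne n 0 with rfl | h0
    · rwa [wordFilt_one] at hn
    · refine ih hy (h.mem_of_annihilated h0 (P := ⊥) ?_ ?_ ?_ ?_ hn hy)
      · intro j w hw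
        simp [(Submodule.mem_bot ℂ).1 hw]
      · intro i j w hw
        simp [(Submodule.mem_bot ℂ).1 hw]
      · exact fun i j hij w hw => hlt i j hij w (mem_wordSpan.2 ⟨n, hw⟩)
      -- A partial `w` is itself a shorter word, and the diagonal puts it in `K`, which the `y i`
      -- preserve. By induction it lies in `D`, hence in `D ∩ K = 0`.
      · intro i w hw hpw
        have hwK := hdiag i w (mem_wordSpan.2 ⟨n, hw⟩) hpw
        exact hDK w (ih (fun i => hyK i w hwK) hw) hwK

/-- The case in which the `y i` shorten words and the errors are shorter words again. -/
theorem mem_of_annihilated_filt (h : IsLowering D x y p s fun n => wordFilt D x (n - 1))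
    (hyp : ∀ i k u, y i (p k k u) = p k k (y i u))
    (hy : ∀ n i, ∀ u ∈ wordFilt D x (n + 1), y i u ∈ wordFilt D x n)
    (hp : ∀ n i j, ∀ u ∈ wordFilt D x n, p i j u ∈ wordFilt D x n)
    (hlt : ∀ n i j, j < i → ∀ u ∈ wordFilt D x (n + 1), p i j u ∈ wordFilt D x n)
    (hdiag : ∀ i, ∀ w ∈ D, p i i w = 0 → w = 0) (n : ℕ)
    {u : X} (hu : u ∈ wordFilt D x (n + 2)) (hyu : ∀ i, y i u ∈ wordFilt D x n) :
    u ∈ wordFilt D x (n + 1) := by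
  have step : ∀ n, (∀ i, ∀ w ∈ wordFilt D x (n + 1), p i i w ∈ wordFilt D x n →
      w ∈ wordFilt D x n) → ∀ u ∈ wordFilt D x (n + 2), (∀ i, y i u ∈ wordFilt D x n) →
      u ∈ wordFilt D x (n + 1) := fun n hn u hu hyu =>
    h.mem_of_annihilated (Nat.succ_ne_zero n) (P := wordFilt D x n)
      (fun j w hw => map_mem_wordFilt hw j) (fun i j w hw => hp n i j w hw)
      (fun i j hij w hw => hlt n i j hij w hw) hn hu hyu
  -- Nondegeneracy of the diagonal modulo shorter words is derived along with the result: `p i i`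
  -- commutes with each `y k`, so it passes to the shorter word `y k w`, where induction applies;
  -- `step` then shortens `w`.
  have nondeg : ∀ n i, ∀ w ∈ wordFilt D x (n + 1), p i i w ∈ wordFilt D x n →
      w ∈ wordFilt D x n := by
    intro n
    induction n with
    | zero =>
      intro i w hw hpw
      rw [wordFilt_one] at hw
      exact (Submodule.mem_bot ℂ).2 (hdiag i w hw ((Submodule.mem_bot ℂ).1 hpw))
    | succ n ih =>
      intro i w hw hpw
      refine step n ih w hw fun k => ih i _ (hy _ k w hw) ?_
      rw [← hyp]
      exact hy _ k _ hpw
  exact step n (nondeg n) u hu hyu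

end IsLowering

/-! ### Operators that preserve words -/

/-- A family of operators that preserves `D`, and preserves words by induction on their length,
preserves the word filtration. -/
theorem family_mem_wordFilt {ι : Type*} {f : ι → Module.End ℂ X} (hD : ∀ i, ∀ u ∈ D, f i u ∈ D)
    (hx : ∀ n i j, ∀ u ∈ wordFilt D x n, (∀ i, f i u ∈ wordFilt D x n) →
      f i (x j u) ∈ wordFilt D x (n + 1)) (n : ℕ) (i : ι) {u : X} (hu : u ∈ wordFilt D x n) :
    f i u ∈ wordFilt D x n := by
  induction n generalizing i u with
  | zero => simp [(Submodule.mem_bot ℂ).1 hu]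
  | succ n ih =>
    have : wordFilt D x (n + 1) ≤ (wordFilt D x (n + 1)).comap (f i) :=
      wordFilt_succ_le (fun v hv => le_wordFilt_succ n (hD i v hv))
        fun j v hv => hx n i j v hv fun i => ih i hv
    exact this hu

/-- A family of operators that preserves `D`, and preserves words by induction on their length,
preserves the span of all words. -/
theorem family_mem_wordSpan {ι : Type*} {f : ι → Module.End ℂ X} (hD : ∀ i, ∀ u ∈ D, f i u ∈ D)
    (hx : ∀ i j, ∀ u ∈ wordSpan D x, (∀ i, f i u ∈ wordSpan D x) →
      f i (x j u) ∈ wordSpan D x) (i : ι) {u : X} (hu : u ∈ wordSpan D x) :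
    f i u ∈ wordSpan D x := by
  have : wordSpan D x ≤ ⨅ i, (wordSpan D x).comap (f i) :=
    wordSpan_le (le_iInf fun i v hv => le_wordSpan (hD i v hv)) fun j v hv hv' =>
      (Submodule.mem_iInf _).2 fun i => hx i j v hv ((Submodule.mem_iInf _).1 hv')
  exact (Submodule.mem_iInf _).1 (this hu) i

/-- An operator that kills `D` and commutes with the letters up to a sign kills all words. -/
theorem eq_zero_of_mem_wordSpan {f : Module.End ℂ X} {s : ℂ} (hD : ∀ u ∈ D, f u = 0)
    (hx : ∀ j u, f (x j u) = s • x j (f u)) {u : X} (hu : u ∈ wordSpan D x) : f u = 0 := by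
  have : wordSpan D x ≤ LinearMap.ker f :=
    wordSpan_le (fun v hv => hD v hv) fun j v _ hv => by
      rw [LinearMap.mem_ker, hx, LinearMap.mem_ker.1 hv, map_zero, smul_zero]
  exact this hu

end WordFiltration

namespace BMS

/-! ### The brackets as operator identities -/

section Relations

variable {X : Type*} [AddCommGroup X] [Module ℂ X] [SuperSpace X] [LieSupermodule BMS X]

theorem act_act (i j : BMSIndex) (v : X) :
    superAct X (e i) (superAct X (e j) v) =
      superSign (par i) (par j) • superAct X (e j) (superAct X (e i) v) +
        superAct X (br i j) v := by
  have h := LieSupermodule.act_bracket (L := BMS) (V := X) (x := e i) (y := e j)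
    (a := par i) (b := par j) (e_mem rfl) (e_mem rfl) v
  have hb : LieSuperalgebra.bracket (e i) (e j) = br i j := bracketMap_e i j
  rw [hb] at h
  rw [superAct, h]
  abel

theorem act_M_M (a b : ℤ) (v : X) :
    superAct X (M a) (superAct X (M b) v) = superAct X (M b) (superAct X (M a) v) := by
  simpa [br, par, superSign, M] using act_act (.M a) (.M b) v

theorem act_M_Q (a b : ℤ) (v : X) :
    superAct X (M a) (superAct X (Q b) v) = superAct X (Q b) (superAct X (M a) v) := by
  simpa [br, par, superSign, M, Q] using act_act (.M a) (.Q b) v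

theorem act_c₁ (i : BMSIndex) (v : X) :
    superAct X c₁ (superAct X (e i) v) = superAct X (e i) (superAct X c₁ v) := by
  simpa [br, par, superSign, c₁] using act_act .c₁ i v

theorem act_c₂ (i : BMSIndex) (v : X) :
    superAct X c₂ (superAct X (e i) v) = superAct X (e i) (superAct X c₂ v) := by
  simpa [br, par, superSign, c₂] using act_act .c₂ i v

theorem act_br_L_M (a b : ℤ) (v : X) : superAct X (br (.L a) (.M b)) v =
    ((a : ℂ) - b) • superAct X (M (a + b)) v +
      (if a + b = 0 then (1 / 12 : ℂ) * ((a : ℂ) ^ 3 - a) else 0) • superAct X c₂ v := by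
  simp only [br, superAct, map_add, map_smul, LinearMap.add_apply, LinearMap.smul_apply]

theorem act_br_M_L (a b : ℤ) (v : X) : superAct X (br (.M a) (.L b)) v =
    -(((b : ℂ) - a) • superAct X (M (b + a)) v +
      (if b + a = 0 then (1 / 12 : ℂ) * ((b : ℂ) ^ 3 - b) else 0) • superAct X c₂ v) := by
  simp only [br, superAct, map_add, map_neg, map_smul, LinearMap.add_apply, LinearMap.neg_apply,
    LinearMap.smul_apply]

theorem act_br_Q_Q (a b : ℤ) (v : X) : superAct X (br (.Q a) (.Q b)) v =
    (2 : ℂ) • superAct X (M (a + b - 1)) v +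
      (if a + b - 1 = 0 then (1 / 3 : ℂ) * (((a : ℂ) - 1 / 2) ^ 2 - 1 / 4) else 0) •
        superAct X c₂ v := by
  simp only [br, superAct, map_add, map_smul, LinearMap.add_apply, LinearMap.smul_apply]

theorem act_L_M (a b : ℤ) (v : X) :
    superAct X (L a) (superAct X (M b) v) = superAct X (M b) (superAct X (L a) v) +
      (((a : ℂ) - b) • superAct X (M (a + b)) v +
      (if a + b = 0 then (1 / 12 : ℂ) * ((a : ℂ) ^ 3 - a) else 0) • superAct X c₂ v) := by
  have h := act_act (X := X) (.L a) (.M b) v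
  rw [act_br_L_M] at h
  simp only [par, superSign, ZMod.val_zero, mul_zero, pow_zero, one_smul] at h
  exact h

theorem act_L_L (a b : ℤ) (v : X) :
    superAct X (L a) (superAct X (L b) v) = superAct X (L b) (superAct X (L a) v) +
      (((a : ℂ) - b) • superAct X (L (a + b)) v +
      (if a + b = 0 then (1 / 12 : ℂ) * ((a : ℂ) ^ 3 - a) else 0) • superAct X c₁ v) := by
  have h := act_act (X := X) (.L a) (.L b) v
  simp only [br, superAct, par, superSign, ZMod.val_zero, mul_zero, pow_zero, one_smul, map_add,
    map_smul, LinearMap.add_apply, LinearMap.smul_apply] at h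
  exact h

theorem act_L_Q (a b : ℤ) (v : X) :
    superAct X (L a) (superAct X (Q b) v) = superAct X (Q b) (superAct X (L a) v) +
      ((a : ℂ) / 2 - ((b : ℂ) - 1 / 2)) • superAct X (Q (a + b)) v := by
  have h := act_act (X := X) (.L a) (.Q b) v
  simp only [br, superAct, par, superSign, ZMod.val_zero, zero_mul, pow_zero, one_smul, map_smul,
    LinearMap.smul_apply] at h
  exact h

theorem act_Q_Q (a b : ℤ) (v : X) :
    superAct X (Q a) (superAct X (Q b) v) = (-1 : ℂ) • superAct X (Q b) (superAct X (Q a) v) +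
      ((2 : ℂ) • superAct X (M (a + b - 1)) v +
      (if a + b - 1 = 0 then (1 / 3 : ℂ) * (((a : ℂ) - 1 / 2) ^ 2 - 1 / 4) else 0) •
        superAct X c₂ v) := by
  have h := act_act (X := X) (.Q a) (.Q b) v
  rw [act_br_Q_Q] at h
  simp only [par, superSign, ZMod.val_one, mul_one, pow_one] at h
  exact h

theorem act_M_L (a b : ℤ) (v : X) :
    superAct X (M a) (superAct X (L b) v) = superAct X (L b) (superAct X (M a) v) -
      (((b : ℂ) - a) • superAct X (M (b + a)) v +
      (if b + a = 0 then (1 / 12 : ℂ) * ((b : ℂ) ^ 3 - b) else 0) • superAct X c₂ v) := by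
  rw [act_L_M]; abel

theorem act_Q_L (a b : ℤ) (v : X) :
    superAct X (Q a) (superAct X (L b) v) = superAct X (L b) (superAct X (Q a) v) -
      ((b : ℂ) / 2 - ((a : ℂ) - 1 / 2)) • superAct X (Q (b + a)) v := by
  rw [act_L_Q]; abel

end Relations

/-- A subspace `D` of a `𝔤`-module that is stable under `𝔤^{(0,-q)}`, is annihilated by `M_i`,
`Q_{i+1/2}` for `i > t` resp. `i ≥ t`, and by `L_i` for `i > t + q`, and generates the module. -/
structure IsVacuum (q t : ℕ) {X : Type*} [AddCommGroup X] [Module ℂ X] [SuperSpace X]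
    [LieSupermodule BMS X] (D : Submodule ℂ X) : Prop where
  stable : ∀ i ∈ subIndex q, ∀ u ∈ D, superAct X (e i) u ∈ D
  M_zero : ∀ i : ℤ, t < i → ∀ u ∈ D, superAct X (M i) u = 0
  Q_zero : ∀ i : ℤ, t < i → ∀ u ∈ D, superAct X (Q i) u = 0
  L_zero : ∀ i : ℤ, t + q < i → ∀ u ∈ D, superAct X (L i) u = 0
  generates : ∀ S : Submodule ℂ X, D ≤ S → (∀ i, ∀ u ∈ S, superAct X (e i) u ∈ S) → S = ⊤

/-! ### Spanning words in three layers over a vacuum space -/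

noncomputable section Spans

variable {X : Type*} [AddCommGroup X] [Module ℂ X] [SuperSpace X] [LieSupermodule BMS X]

/-- The operators `M_{-q-1}, M_{-q-2}, …` -/
def mLetter (X : Type*) [AddCommGroup X] [Module ℂ X] [SuperSpace X] [LieSupermodule BMS X]
    (q j : ℕ) : Module.End ℂ X := superAct X (M (-q - 1 - j))

/-- The operators `Q_{-1/2}, Q_{-3/2}, …` -/
def qLetter (X : Type*) [AddCommGroup X] [Module ℂ X] [SuperSpace X] [LieSupermodule BMS X]
    (j : ℕ) : Module.End ℂ X := superAct X (Q (-j))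

/-- The operators `L_{-1}, L_{-2}, …` -/
def lLetter (X : Type*) [AddCommGroup X] [Module ℂ X] [SuperSpace X] [LieSupermodule BMS X]
    (j : ℕ) : Module.End ℂ X := superAct X (L (-1 - j))

/-- The span of the words in `M_{-q-1}, M_{-q-2}, …` applied to `D`. -/
def mSpan (q : ℕ) (D : Submodule ℂ X) : Submodule ℂ X := wordSpan D (mLetter X q)

/-- The span of the words in `Q_{-1/2}, Q_{-3/2}, …` applied to `mSpan q D`. -/
def mqSpan (q : ℕ) (D : Submodule ℂ X) : Submodule ℂ X := wordSpan (mSpan q D) (qLetter X)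

variable {q t : ℕ} {D : Submodule ℂ X}

namespace IsVacuum

theorem c₁_mem_mSpan (h : IsVacuum q t D) {u : X} (hu : u ∈ mSpan q D) :
    superAct X c₁ u ∈ mSpan q D :=
  family_mem_wordSpan (f := fun _ : Unit => superAct X c₁)
    (fun _ => h.stable .c₁ (by simp [subIndex]))
    (fun _ j u _ hu' => by
      rw [mLetter, M, act_c₁]
      exact map_mem_wordSpan (hu' ()) j) () hu

theorem c₂_mem_mSpan (h : IsVacuum q t D) {u : X} (hu : u ∈ mSpan q D) :
    superAct X c₂ u ∈ mSpan q D :=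
  family_mem_wordSpan (f := fun _ : Unit => superAct X c₂)
    (fun _ => h.stable .c₂ (by simp [subIndex]))
    (fun _ j u _ hu' => by
      rw [mLetter, M, act_c₂]
      exact map_mem_wordSpan (hu' ()) j) () hu

theorem M_mem_mSpan (h : IsVacuum q t D) (a : ℤ) {u : X} (hu : u ∈ mSpan q D) :
    superAct X (M a) u ∈ mSpan q D := by
  rcases le_or_gt (-(q : ℤ)) a with ha | ha
  · exact family_mem_wordSpan (f := fun _ : Unit => superAct X (M a))
      (fun _ => h.stable (.M a) (by simpa [subIndex] using ha))
      (fun _ j u _ hu' => by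
        rw [mLetter, act_M_M]
        exact map_mem_wordSpan (hu' ()) j) () hu
  · obtain ⟨j, rfl⟩ : ∃ j : ℕ, a = -q - 1 - j := ⟨(-q - 1 - a).toNat, by omega⟩
    exact map_mem_wordSpan hu j

theorem Q_mem_mSpan (h : IsVacuum q t D) {a : ℤ} (ha : 1 ≤ a) {u : X} (hu : u ∈ mSpan q D) :
    superAct X (Q a) u ∈ mSpan q D :=
  family_mem_wordSpan (f := fun _ : Unit => superAct X (Q a))
    (fun _ => h.stable (.Q a) (by simpa [subIndex] using ha))
    (fun _ j u _ hu' => by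
      rw [mLetter, ← act_M_Q]
      exact map_mem_wordSpan (hu' ()) j) () hu

theorem L_mem_mSpan (h : IsVacuum q t D) {a : ℤ} (ha : 0 ≤ a) {u : X} (hu : u ∈ mSpan q D) :
    superAct X (L a) u ∈ mSpan q D :=
  family_mem_wordSpan (f := fun _ : Unit => superAct X (L a))
    (fun _ => h.stable (.L a) (by simpa [subIndex] using ha))
    (fun _ j u hu hu' => by
      rw [mLetter, act_L_M]
      exact add_mem (map_mem_wordSpan (hu' ()) j)
        (add_mem (Submodule.smul_mem _ _ (h.M_mem_mSpan _ hu))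
          (Submodule.smul_mem _ _ (h.c₂_mem_mSpan hu)))) () hu

theorem M_mSpan_eq_zero (h : IsVacuum q t D) {a : ℤ} (ha : t < a) {u : X} (hu : u ∈ mSpan q D) :
    superAct X (M a) u = 0 :=
  eq_zero_of_mem_wordSpan (s := 1) (h.M_zero a ha) (fun j u => by
    rw [one_smul, mLetter, act_M_M]) hu

theorem Q_mSpan_eq_zero (h : IsVacuum q t D) {a : ℤ} (ha : t < a) {u : X} (hu : u ∈ mSpan q D) :
    superAct X (Q a) u = 0 :=
  eq_zero_of_mem_wordSpan (s := 1) (h.Q_zero a ha) (fun j u => by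
    rw [one_smul, mLetter, act_M_Q]) hu

theorem c₁_mem_mqSpan (h : IsVacuum q t D) {u : X} (hu : u ∈ mqSpan q D) :
    superAct X c₁ u ∈ mqSpan q D :=
  family_mem_wordSpan (f := fun _ : Unit => superAct X c₁)
    (fun _ _ => h.c₁_mem_mSpan)
    (fun _ j u _ hu' => by
      rw [qLetter, Q, act_c₁]
      exact map_mem_wordSpan (hu' ()) j) () hu

theorem c₂_mem_mqSpan (h : IsVacuum q t D) {u : X} (hu : u ∈ mqSpan q D) :
    superAct X c₂ u ∈ mqSpan q D :=
  family_mem_wordSpan (f := fun _ : Unit => superAct X c₂)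
    (fun _ _ => h.c₂_mem_mSpan)
    (fun _ j u _ hu' => by
      rw [qLetter, Q, act_c₂]
      exact map_mem_wordSpan (hu' ()) j) () hu

theorem M_mem_filt (h : IsVacuum q t D) (n : ℕ) (a : ℤ) {u : X}
    (hu : u ∈ wordFilt (mSpan q D) (qLetter X) n) :
    superAct X (M a) u ∈ wordFilt (mSpan q D) (qLetter X) n :=
  family_mem_wordFilt (f := fun _ : Unit => superAct X (M a))
    (fun _ _ => h.M_mem_mSpan a)
    (fun n _ j u _ hu' => by
      rw [qLetter, act_M_Q]
      exact map_mem_wordFilt (hu' ()) j) n () hu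

theorem c₂_mem_filt (h : IsVacuum q t D) (n : ℕ) {u : X}
    (hu : u ∈ wordFilt (mSpan q D) (qLetter X) n) :
    superAct X c₂ u ∈ wordFilt (mSpan q D) (qLetter X) n :=
  family_mem_wordFilt (f := fun _ : Unit => superAct X c₂)
    (fun _ _ => h.c₂_mem_mSpan)
    (fun n _ j u _ hu' => by
      rw [qLetter, Q, act_c₂]
      exact map_mem_wordFilt (hu' ()) j) n () hu

theorem M_mem_mqSpan (h : IsVacuum q t D) (a : ℤ) {u : X} (hu : u ∈ mqSpan q D) :
    superAct X (M a) u ∈ mqSpan q D := by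
  obtain ⟨n, hn⟩ := mem_wordSpan.1 hu
  exact mem_wordSpan.2 ⟨n, h.M_mem_filt n a hn⟩

theorem Q_mem_mqSpan (h : IsVacuum q t D) (a : ℤ) {u : X} (hu : u ∈ mqSpan q D) :
    superAct X (Q a) u ∈ mqSpan q D := by
  rcases le_or_gt 1 a with ha | ha
  · exact family_mem_wordSpan (f := fun _ : Unit => superAct X (Q a))
      (fun _ _ => h.Q_mem_mSpan ha)
      (fun _ j u hu hu' => by
        rw [qLetter, act_Q_Q]
        exact add_mem (Submodule.smul_mem _ _ (map_mem_wordSpan (hu' ()) j))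
          (add_mem (Submodule.smul_mem _ _ (h.M_mem_mqSpan _ hu))
            (Submodule.smul_mem _ _ (h.c₂_mem_mqSpan hu)))) () hu
  · obtain ⟨j, rfl⟩ : ∃ j : ℕ, a = -j := ⟨(-a).toNat, by omega⟩
    exact map_mem_wordSpan hu j

theorem L_mem_mqSpan (h : IsVacuum q t D) {a : ℤ} (ha : 0 ≤ a) {u : X} (hu : u ∈ mqSpan q D) :
    superAct X (L a) u ∈ mqSpan q D :=
  family_mem_wordSpan (f := fun _ : Unit => superAct X (L a))
    (fun _ _ => h.L_mem_mSpan ha)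
    (fun _ j u hu hu' => by
      rw [qLetter, act_L_Q]
      exact add_mem (map_mem_wordSpan (hu' ()) j)
        (Submodule.smul_mem _ _ (h.Q_mem_mqSpan _ hu))) () hu

theorem M_mqSpan_eq_zero (h : IsVacuum q t D) {a : ℤ} (ha : t < a) {u : X}
    (hu : u ∈ mqSpan q D) : superAct X (M a) u = 0 :=
  eq_zero_of_mem_wordSpan (s := 1) (fun _ => h.M_mSpan_eq_zero ha) (fun j u => by
    rw [one_smul, qLetter, act_M_Q]) hu

theorem c₂_mem_lFilt (h : IsVacuum q t D) (n : ℕ) {u : X}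
    (hu : u ∈ wordFilt (mqSpan q D) (lLetter X) n) :
    superAct X c₂ u ∈ wordFilt (mqSpan q D) (lLetter X) n :=
  family_mem_wordFilt (f := fun _ : Unit => superAct X c₂)
    (fun _ _ => h.c₂_mem_mqSpan)
    (fun n _ j u _ hu' => by
      rw [lLetter, L, act_c₂]
      exact map_mem_wordFilt (hu' ()) j) n () hu

theorem c₁_mem_lFilt (h : IsVacuum q t D) (n : ℕ) {u : X}
    (hu : u ∈ wordFilt (mqSpan q D) (lLetter X) n) :
    superAct X c₁ u ∈ wordFilt (mqSpan q D) (lLetter X) n :=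
  family_mem_wordFilt (f := fun _ : Unit => superAct X c₁)
    (fun _ _ => h.c₁_mem_mqSpan)
    (fun n _ j u _ hu' => by
      rw [lLetter, L, act_c₁]
      exact map_mem_wordFilt (hu' ()) j) n () hu

/-- Moving `M_a` past an `L` produces an `M` with another index and one letter fewer, so the
induction has to run over all `a` at once. -/
theorem M_mem_lFilt (h : IsVacuum q t D) (n : ℕ) (a : ℤ) {u : X}
    (hu : u ∈ wordFilt (mqSpan q D) (lLetter X) n) :
    superAct X (M a) u ∈ wordFilt (mqSpan q D) (lLetter X) n :=
  family_mem_wordFilt (f := fun a : ℤ => superAct X (M a))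
    (fun a _ => h.M_mem_mqSpan a)
    (fun n a j u hu hu' => by
      rw [lLetter, act_M_L]
      exact sub_mem (map_mem_wordFilt (hu' a) j) (wordFilt_le_succ n
        (add_mem (Submodule.smul_mem _ _ (hu' _))
          (Submodule.smul_mem _ _ (h.c₂_mem_lFilt n hu))))) n a hu

/-- `M_a` kills the bottom layer, and each commutator with an `L` uses up one letter. This is what
makes `M_a` an annihilation operator for words in the `L`s. -/
theorem M_mem_lFilt_of_lt (h : IsVacuum q t D) (n : ℕ) {a : ℤ} (ha : t < a) {u : X}
    (hu : u ∈ wordFilt (mqSpan q D) (lLetter X) (n + 1)) :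
    superAct X (M a) u ∈ wordFilt (mqSpan q D) (lLetter X) n := by
  have H : ∀ n, wordFilt (mqSpan q D) (lLetter X) (n + 1) ≤
      (wordFilt (mqSpan q D) (lLetter X) n).comap (superAct X (M a)) := by
    intro n
    induction n with
    | zero =>
      rw [wordFilt_one]
      intro v hv
      simp only [Submodule.mem_comap, h.M_mqSpan_eq_zero ha hv, zero_mem]
    | succ n ih =>
      refine wordFilt_succ_le (fun v hv => ?_) fun j v hv => ?_
      · simp only [Submodule.mem_comap, h.M_mqSpan_eq_zero ha hv, zero_mem]
      · rw [Submodule.mem_comap, lLetter, act_M_L]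
        exact sub_mem (map_mem_wordFilt (ih hv) j)
          (add_mem (Submodule.smul_mem _ _ (h.M_mem_lFilt _ _ hv))
            (Submodule.smul_mem _ _ (h.c₂_mem_lFilt _ hv)))
  exact H n hu

/-- The words in `L_{-1}, L_{-2}, …`, the `Q_{-1/2}, Q_{-3/2}, …` and the `M_{-q-1}, M_{-q-2}, …`,
in this order, applied to `D` span the module. -/
theorem wordSpan_eq_top (h : IsVacuum q t D) : wordSpan (mqSpan q D) (lLetter X) = ⊤ := by
  have hc₁ : ∀ u ∈ wordSpan (mqSpan q D) (lLetter X),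
      superAct X c₁ u ∈ wordSpan (mqSpan q D) (lLetter X) := fun u hu => by
    obtain ⟨n, hn⟩ := mem_wordSpan.1 hu
    exact mem_wordSpan.2 ⟨n, h.c₁_mem_lFilt n hn⟩
  have hQ : ∀ a : ℤ, ∀ u ∈ wordSpan (mqSpan q D) (lLetter X),
      superAct X (Q a) u ∈ wordSpan (mqSpan q D) (lLetter X) := fun a u hu =>
    family_mem_wordSpan (f := fun a : ℤ => superAct X (Q a))
      (fun a _ => h.Q_mem_mqSpan a)
      (fun a j u _ hu' => by
        rw [lLetter, act_Q_L]
        exact sub_mem (map_mem_wordSpan (hu' a) j) (Submodule.smul_mem _ _ (hu' _))) a hu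
  have hneg : ∀ a : ℤ, a < 0 → ∀ u ∈ wordSpan (mqSpan q D) (lLetter X),
      superAct X (L a) u ∈ wordSpan (mqSpan q D) (lLetter X) := fun a ha u hu => by
    obtain ⟨j, rfl⟩ : ∃ j : ℕ, a = -1 - j := ⟨(-1 - a).toNat, by omega⟩
    exact map_mem_wordSpan hu j
  have hL : ∀ a : ℤ, ∀ u ∈ wordSpan (mqSpan q D) (lLetter X),
      superAct X (L a) u ∈ wordSpan (mqSpan q D) (lLetter X) := fun a u hu => by
    rcases lt_or_ge a 0 with ha | ha
    · exact hneg a ha u hu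
    · lift a to ℕ using ha
      -- The commutator of `L_a` with a letter is either again a letter or a member of the same
      -- nonnegative family, up to a scalar and a central term.
      refine family_mem_wordSpan (f := fun a : ℕ => superAct X (L a))
        (fun a _ => h.L_mem_mqSpan (by omega))
        (fun a j u hu hu' => ?_) a hu
      rw [lLetter, act_L_L]
      refine add_mem (map_mem_wordSpan (hu' a) j) (add_mem (Submodule.smul_mem _ _ ?_)
        (Submodule.smul_mem _ _ (hc₁ u hu)))
      rcases lt_or_ge ((a : ℤ) + (-1 - j)) 0 with hb | hb
      · exact hneg _ hb u hu
      · obtain ⟨b, hb'⟩ := Int.eq_ofNat_of_zero_le hb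
        rw [hb']
        exact hu' b
  refine h.generates _ ((le_wordSpan.trans le_wordSpan).trans le_wordSpan) ?_
  rintro (a | a | a | _ | _) u hu
  · exact hL a u hu
  · obtain ⟨n, hn⟩ := mem_wordSpan.1 hu
    exact mem_wordSpan.2 ⟨n, h.M_mem_lFilt n a hn⟩
  · exact hQ a u hu
  · exact hc₁ u hu
  · obtain ⟨n, hn⟩ := mem_wordSpan.1 hu
    exact mem_wordSpan.2 ⟨n, h.c₂_mem_lFilt n hn⟩

end IsVacuum

end Spans

end BMS

namespace BMS

/-! ### Stripping off the layers by annihilation operators -/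

section Annihilation

variable {X : Type*} [AddCommGroup X] [Module ℂ X] [SuperSpace X] [LieSupermodule BMS X]

/-- A submodule `K` such that `M_t`, resp. the `M_0 + (n² - 1)/24 𝐜₂` if `t = 0`, are injective
modulo `K` on the vectors that are annihilated modulo `K` by the `M_i` with `i > t`. -/
structure IsNondegenerateMod (t : ℕ) (K : Submodule ℂ X) : Prop where
  stable : ∀ i, ∀ u ∈ K, superAct X (e i) u ∈ K
  nondeg : ∀ n : ℤ, n ≠ 0 → ∀ u, (∀ i : ℤ, t < i → superAct X (M i) u ∈ K) →
    superAct X (M t) u + (if t = 0 then (1 / 24 : ℂ) * ((n : ℂ) ^ 2 - 1) else 0) • superAct X c₂ u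
      ∈ K → u ∈ K

theorem IsNondegenerateMod.mem {t : ℕ} {K : Submodule ℂ X} (hK : IsNondegenerateMod t K) {n : ℤ}
    (hn : n ≠ 0) {α : ℂ} (hα : α ≠ 0) {u : X} (hu : ∀ i : ℤ, t < i → superAct X (M i) u ∈ K)
    (h : α • superAct X (M t) u +
      (if t = 0 then α * ((1 / 24 : ℂ) * ((n : ℂ) ^ 2 - 1)) else 0) • superAct X c₂ u ∈ K) :
    u ∈ K := by
  refine hK.nondeg n hn u hu ((Submodule.smul_mem_iff K hα).1 ?_)
  convert h using 1
  split_ifs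
  · module
  · simp

variable {q t : ℕ} {D K : Submodule ℂ X}

namespace IsVacuum

/-- The letters commute with each other and with their brackets with the `L`s, so the relations hold
exactly. The space `K` enters only because vanishing will be tested modulo `K`. -/
theorem mLetter_isLowering (h : IsVacuum q t D) (hK : IsNondegenerateMod t K) :
    IsLowering D (mLetter X q) (fun i => superAct X (L (t + q + 1 + i)))
      (fun i j => superAct X (br (.L (t + q + 1 + i)) (.M (-q - 1 - j)))) 1 (fun _ => K) where
  sign := one_mul 1
  comm n j a u _ := by
    rw [mLetter, mLetter, act_M_M, one_smul, sub_self]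
    exact zero_mem _
  bracket i j u := by
    rw [one_smul, mLetter, act_L_M, act_br_L_M]
  annihilates i u hu := h.L_zero _ (by omega) u hu
  map_err n a u hu := hK.stable _ u hu
  almost_comm n i j a u _ := by
    rw [act_br_L_M, act_br_L_M, mLetter, map_add, map_smul, map_smul, act_M_M, M, M, act_c₂,
      sub_self]
    exact zero_mem _

/-- The fermionic case `s = -1`: the letters anticommute up to `M`s and `𝐜₂`, which do not lengthen
words, and these commute with every `Q`. -/
theorem qLetter_isLowering (h : IsVacuum q t D) (hK : IsNondegenerateMod t K) :
    IsLowering (mSpan q D) (qLetter X) (fun i => superAct X (Q (t + 1 + i)))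
      (fun i j => superAct X (br (.Q (t + 1 + i)) (.Q (-j)))) (-1) (fun _ => K) where
  sign := by norm_num
  comm n j a u hu := by
    rw [qLetter, qLetter, act_Q_Q, add_sub_cancel_left]
    exact wordFilt_le_succ n (add_mem (Submodule.smul_mem _ _ (h.M_mem_filt n _ hu))
      (Submodule.smul_mem _ _ (h.c₂_mem_filt n hu)))
  bracket i j u := by
    rw [qLetter, act_Q_Q, act_br_Q_Q]
  annihilates i u hu := h.Q_mSpan_eq_zero (by omega) hu
  map_err n a u hu := hK.stable _ u hu
  almost_comm n i j a u _ := by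
    rw [act_br_Q_Q, act_br_Q_Q, qLetter, map_add, map_smul, map_smul, act_M_Q, Q, act_c₂,
      sub_self]
    exact zero_mem _

/-- The bracket of two letters is a multiple of one letter, without a central term since the index
stays negative. Here the `p i j` do not commute with the letters, but their commutators involve only
`M`s and `𝐜₂` and so do not lengthen words; this is why the errors are shorter words. -/
theorem lLetter_isLowering (h : IsVacuum q t D) :
    IsLowering (mqSpan q D) (lLetter X) (fun i => superAct X (M (t + 1 + i)))
      (fun i j => superAct X (br (.M (t + 1 + i)) (.L (-1 - j)))) 1
      (fun n => wordFilt (mqSpan q D) (lLetter X) (n - 1)) where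
  sign := one_mul 1
  comm n j a u hu := by
    have e0 : ¬((-1 - j : ℤ) + (-1 - a) = 0) := by omega
    rw [lLetter, lLetter, act_L_L, one_smul, add_sub_cancel_left, if_neg e0, zero_smul, add_zero]
    obtain ⟨k, hk⟩ : ∃ k : ℕ, (-1 - j : ℤ) + (-1 - a) = -1 - k := ⟨j + a + 1, by omega⟩
    rw [hk]
    exact Submodule.smul_mem _ _ (map_mem_wordFilt hu k)
  bracket i j u := by
    rw [one_smul, lLetter, act_M_L, act_br_M_L, sub_eq_add_neg]
  annihilates i u hu := h.M_mqSpan_eq_zero (by omega) hu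
  map_err n a u hu := by
    -- In degree `0` the truncated `n - 1` is `0`, and the error space is `⊥`.
    rcases n with _ | n
    · rw [(Submodule.mem_bot ℂ).1 hu, map_zero]
      exact zero_mem _
    · exact map_mem_wordFilt hu a
  almost_comm n i j a u hu := by
    rw [Nat.add_sub_cancel, act_br_M_L, act_br_M_L, lLetter, map_neg, map_add, map_smul, map_smul, act_L_M]
    have e : ∀ v, superAct X c₂ (superAct X (L (-1 - a)) v) =
      superAct X (L (-1 - a)) (superAct X c₂ v) := act_c₂ _
    rw [e]
    generalize (-1 - (j : ℤ)) + (t + 1 + i) = b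
    have h1 := h.M_mem_lFilt n ((-1 - a) + b) hu
    have h2 := h.c₂_mem_lFilt n hu
    convert Submodule.smul_mem _ (-((-1 - j : ℤ) - (t + 1 + i : ℤ) : ℂ))
      (add_mem (Submodule.smul_mem _ ((-1 - a : ℤ) - b : ℂ) h1) (Submodule.smul_mem _
        (if (-1 - a) + b = 0 then (1 / 12 : ℂ) * (((-1 - a : ℤ) : ℂ) ^ 3 - (-1 - a : ℤ)) else 0) h2))
      using 1
    module

theorem mem_of_annihilated_mSpan (h : IsVacuum q t D) (hK : IsNondegenerateMod t K)
    (hDK : ∀ u ∈ D, u ∈ K → u = 0) {u : X} (hu : u ∈ mSpan q D)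
    (hy : ∀ i : ℤ, t + q < i → superAct X (L i) u ∈ K) : u ∈ D := by
  refine (h.mLetter_isLowering hK).mem_of_annihilated_mod (fun i => hK.stable _) hDK
    ?_ ?_ hu (fun i => hy _ (by omega))
  · intro i j hij w hw
    rw [act_br_L_M, h.M_mSpan_eq_zero (by omega) hw, if_neg (by omega), smul_zero, zero_smul,
      add_zero]
    exact zero_mem _
  · intro i w hw hp
    rw [act_br_L_M] at hp
    have e1 : ((t : ℤ) + q + 1 + i) + (-q - 1 - i) = t := by ring
    rw [e1] at hp
    -- With `m = q + 1 + i` the bracket is `(t + 2m) M_t`, plus `(m³ - m)/12 𝐜₂ = 2m · (m² - 1)/24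
    -- 𝐜₂` if `t = 0`.
    refine hK.mem (n := q + 1 + i) (α := (t + 2 * (q + 1 + i) : ℕ)) (by omega)
      (by norm_cast; omega) (fun k hk => by rw [h.M_mSpan_eq_zero hk hw]; exact zero_mem _) ?_
    convert hp using 3
    · push_cast; ring
    · by_cases ht : t = 0
      · subst ht
        simp only [if_true, Nat.cast_zero]
        push_cast; ring
      · rw [if_neg ht, if_neg (by omega)]

theorem mem_of_annihilated_mqSpan (h : IsVacuum q t D) (hK : IsNondegenerateMod t K)
    (hDK : ∀ u ∈ mSpan q D, u ∈ K → u = 0) {u : X} (hu : u ∈ mqSpan q D)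
    (hy : ∀ i : ℤ, t < i → superAct X (Q i) u ∈ K) : u ∈ mSpan q D := by
  refine (h.qLetter_isLowering hK).mem_of_annihilated_mod (fun i => hK.stable _) hDK
    ?_ ?_ hu (fun i => hy _ (by omega))
  · intro i j hij w hw
    rw [act_br_Q_Q, h.M_mqSpan_eq_zero (by omega) hw, if_neg (by omega), smul_zero, zero_smul,
      add_zero]
    exact zero_mem _
  · intro i w hw hp
    rw [act_br_Q_Q] at hp
    have e1 : ((t : ℤ) + 1 + i) + (-i) - 1 = t := by ring
    rw [e1] at hp
    -- For `t = 0` and `r = i + 1/2`, the central coefficient is `(r² - 1/4)/3 = 2 · ((2i + 1)² -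
    -- 1)/24`.
    refine hK.mem (n := 2 * i + 1) (α := 2) (by omega)
      two_ne_zero (fun k hk => by rw [h.M_mqSpan_eq_zero hk hw]; exact zero_mem _) ?_
    convert hp using 3
    by_cases ht : t = 0
    · subst ht
      simp only [if_true, Nat.cast_zero]
      push_cast; ring
    · rw [if_neg ht, if_neg (by omega)]

theorem mem_of_annihilated_filt (h : IsVacuum q t D) (hK : IsNondegenerateMod t K)
    (hDK : ∀ u ∈ mqSpan q D, u ∈ K → u = 0) (n : ℕ) {u : X}
    (hu : u ∈ wordFilt (mqSpan q D) (lLetter X) (n + 2))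
    (hy : ∀ i : ℤ, t < i → superAct X (M i) u ∈ wordFilt (mqSpan q D) (lLetter X) n) :
    u ∈ wordFilt (mqSpan q D) (lLetter X) (n + 1) := by
  refine h.lLetter_isLowering.mem_of_annihilated_filt ?_ ?_ ?_ ?_ ?_ n hu
    (fun i => hy _ (by omega))
  · intro i k u
    rw [act_br_M_L, act_br_M_L, map_neg, map_add, map_smul, map_smul, act_M_M, M, M, act_c₂]
  · intro n i u hu
    exact h.M_mem_lFilt_of_lt n (by omega) hu
  · intro n i j u hu
    rw [act_br_M_L]
    exact neg_mem (add_mem (Submodule.smul_mem _ _ (h.M_mem_lFilt n _ hu))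
      (Submodule.smul_mem _ _ (h.c₂_mem_lFilt n hu)))
  · intro n i j hij u hu
    rw [act_br_M_L, if_neg (by omega), zero_smul, add_zero]
    exact neg_mem (Submodule.smul_mem _ _ (h.M_mem_lFilt_of_lt n (by omega) hu))
  · intro i w hw hp
    rw [act_br_M_L, neg_eq_zero] at hp
    have e1 : (-1 - i : ℤ) + (t + 1 + i) = t := by ring
    rw [e1] at hp
    -- With `m = i + 1`, the operator is `-(t + 2m) M_t`, plus `-2m · (m² - 1)/24 𝐜₂` if `t = 0`.
    refine hDK w hw (hK.mem (n := i + 1) (α := -(t + 2 * (i + 1) : ℕ)) (by omega)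
      (neg_ne_zero.2 (by norm_cast))
      (fun k hk => by rw [h.M_mqSpan_eq_zero hk hw]; exact zero_mem _) ?_)
    convert zero_mem K using 1
    rw [← hp]
    congr 2
    · push_cast; ring
    · by_cases ht : t = 0
      · subst ht
        simp only [if_true, Nat.cast_zero]
        push_cast; ring
      · rw [if_neg ht, if_neg (by omega)]

/-- A submodule that meets the vacuum space trivially is trivial. -/
theorem eq_bot (h : IsVacuum q t D) (hK : IsNondegenerateMod t K)
    (hDK : ∀ u ∈ D, u ∈ K → u = 0) : K = ⊥ := by
  have h1 : ∀ u ∈ mSpan q D, u ∈ K → u = 0 := fun u hu huK =>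
    hDK u (h.mem_of_annihilated_mSpan hK hDK hu fun i _ => hK.stable _ _ huK) huK
  have h2 : ∀ u ∈ mqSpan q D, u ∈ K → u = 0 := fun u hu huK =>
    h1 u (h.mem_of_annihilated_mqSpan hK h1 hu fun i _ => hK.stable _ _ huK) huK
  have h3 : ∀ n, ∀ u ∈ wordFilt (mqSpan q D) (lLetter X) (n + 1), u ∈ K → u = 0 := by
    intro n
    induction n with
    | zero => rwa [wordFilt_one]
    | succ n ih =>
      intro u hu huK
      -- `M_i u` lies in `K` and is shorter than `u`, so it is zero by induction; hence `u` itself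
      -- is shorter.
      refine ih u (h.mem_of_annihilated_filt hK h2 n hu fun i hi => ?_) huK
      rw [ih _ (h.M_mem_lFilt_of_lt _ hi hu) (hK.stable _ _ huK)]
      exact zero_mem _
  refine (Submodule.eq_bot_iff K).2 fun u huK => ?_
  obtain ⟨n, hn⟩ := mem_wordSpan.1 (h.wordSpan_eq_top ▸ Submodule.mem_top : u ∈ _)
  exact h3 n u (wordFilt_le_succ n hn) huK

/-- The vacuum space consists of all vectors that are annihilated by the same operators. -/
theorem mem_of_annihilated (h : IsVacuum q t D) (hK : IsNondegenerateMod t (⊥ : Submodule ℂ X))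
    {u : X} (hM : ∀ i : ℤ, t < i → superAct X (M i) u = 0)
    (hQ : ∀ i : ℤ, t < i → superAct X (Q i) u = 0)
    (hL : ∀ i : ℤ, t + q < i → superAct X (L i) u = 0) : u ∈ D := by
  have h0 : ∀ S : Submodule ℂ X, ∀ u ∈ S, u ∈ (⊥ : Submodule ℂ X) → u = 0 := fun _ _ _ hu => hu
  refine h.mem_of_annihilated_mSpan hK (h0 _) (h.mem_of_annihilated_mqSpan hK (h0 _) ?_ hQ) hL
  obtain ⟨n, hn⟩ := mem_wordSpan.1 (h.wordSpan_eq_top ▸ Submodule.mem_top : u ∈ _)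
  replace hn := wordFilt_le_succ n hn
  induction n with
  | zero => rwa [wordFilt_one] at hn
  | succ n ih =>
    exact ih (h.mem_of_annihilated_filt hK (h0 _) n hn fun i hi => by
      rw [hM i hi]; exact zero_mem _)

end IsVacuum

end Annihilation

end BMS

/-! ### Homomorphisms out of induced modules -/

noncomputable section InducedHoms

theorem mem_gr_of_parityOp {V : Type*} [AddCommGroup V] [Module ℂ V] [SuperSpace V]
    {a : ZMod 2} {v : V} (h : parityOp V v = (-1 : ℂ) ^ a.val • v) :
    v ∈ SuperSpace.gr (V := V) a := by
  obtain ⟨v₀, v₁, h₀, h₁, rfl⟩ := SuperSpace.exists_add v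
  rw [map_add, parityOp_apply h₀, parityOp_apply h₁] at h
  rcases zmod2_cases a with rfl | rfl
  · have h' : (2 : ℂ) • v₁ = 0 := by
      simp only [ZMod.val_zero, pow_zero, one_smul, ZMod.val_one, pow_one] at h
      calc (2 : ℂ) • v₁ = (v₀ + v₁) - (v₀ + (-1 : ℂ) • v₁) := by module
        _ = 0 := by rw [h, sub_self]
    rw [(smul_eq_zero_iff_right two_ne_zero).1 h', add_zero]
    exact h₀
  · have h' : (2 : ℂ) • v₀ = 0 := by
      simp only [ZMod.val_zero, pow_zero, one_smul, ZMod.val_one, pow_one] at h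
      calc (2 : ℂ) • v₀ = (v₀ + (-1 : ℂ) • v₁) - (-1 : ℂ) • (v₀ + v₁) := by module
        _ = 0 := by rw [h, sub_self]
    rw [(smul_eq_zero_iff_right two_ne_zero).1 h', zero_add]
    exact h₁

variable {L : Type*} [AddCommGroup L] [Module ℂ L] [LieSuperalgebra L]

theorem SuperEnveloping.induction {p : SuperEnveloping L → Prop}
    (algebraMap : ∀ c : ℂ, p (algebraMap ℂ _ c)) (ι : ∀ x : L, p (superι x))
    (mul : ∀ u u', p u → p u' → p (u * u')) (add : ∀ u u', p u → p u' → p (u + u'))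
    (u : SuperEnveloping L) : p u := by
  obtain ⟨z, rfl⟩ := SuperEnveloping.mkHom_surjective L u
  induction z using TensorAlgebra.induction with
  | algebraMap c => simpa using algebraMap c
  | ι x => exact ι x
  | mul z z' h h' => simpa using mul _ _ h h'
  | add z z' h h' => simpa using add _ _ h h'

section EnvAct

variable (W : Type*) [AddCommGroup W] [Module ℂ W] [SuperSpace W] [LieSupermodule L W]

/-- The action of the enveloping algebra on a module. -/
def envAct : SuperEnveloping L →ₐ[ℂ] Module.End ℂ W :=
  SuperEnveloping.descend (TensorAlgebra.lift ℂ (LieSupermodule.act (L := L) (V := W))) (by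
    rintro _ _ ⟨hx, hy⟩
    ext w
    simp only [map_mul, map_add, map_smul, TensorAlgebra.lift_ι_apply, LinearMap.add_apply,
      LinearMap.smul_apply, Module.End.mul_apply, LieSupermodule.act_bracket hx hy]
    abel)

theorem envAct_ι (x : L) : envAct W (superι x) = superAct W x := by
  simp [envAct, superι, SuperEnveloping.descend_mkHom]

theorem parityOp_envAct (u : SuperEnveloping L) (w : W) :
    parityOp W (envAct W u w) = envAct W (superParity L u) (parityOp W w) := by
  induction u using SuperEnveloping.induction generalizing w with
  | algebraMap c => simp
  | ι x => rw [envAct_ι, parityOp_act, superParity_ι, envAct_ι]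
  | mul u u' h h' => simp [h, h']
  | add u u' h h' => simp [h, h']

end EnvAct

namespace InducedModule

variable {H : LieSubsuperalgebra L}
  {V : Type*} [AddCommGroup V] [Module ℂ V] [SuperSpace V] [LieSupermodule H.carrier V]
  {W : Type*} [AddCommGroup W] [Module ℂ W] [SuperSpace W] [LieSupermodule L W]

/-- The homomorphism `Ind V → W` that extends an `H`-linear map `V → W`. -/
def lift (f : V →ₗ[ℂ] W)
    (hf : ∀ (h : H.carrier) (v : V), f (superAct V h v) = superAct W (h : L) (f v)) :
    InducedModule H V →ₗ[ℂ] W :=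
  (inductionRel H V).liftQ
    (TensorProduct.lift (LinearMap.lcomp ℂ W f ∘ₗ (envAct (L := L) W).toLinearMap)) (by
      refine Submodule.span_le.2 ?_
      rintro _ ⟨u, h, v, rfl⟩
      simp [hf, envAct_ι])

variable {f : V →ₗ[ℂ] W}
  (hf : ∀ (h : H.carrier) (v : V), f (superAct V h v) = superAct W (h : L) (f v))

theorem lift_mk (u : SuperEnveloping L) (v : V) :
    lift f hf (mk H V (u ⊗ₜ v)) = envAct W u (f v) := rfl

theorem lift_mulLeft (u : SuperEnveloping L) (w : InducedModule H V) :
    lift f hf (mulLeft H V u w) = envAct W u (lift f hf w) := by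
  induction w using induction_on with
  | tmul u' v => simp [mulLeft_mk, lift_mk]
  | zero => simp
  | add w w' h h' => simp [h, h']

theorem act_eq_mulLeft (x : L) (w : InducedModule H V) :
    superAct (InducedModule H V) x w = mulLeft H V (superι x) w := rfl

theorem lift_act (x : L) (w : InducedModule H V) :
    lift f hf (superAct (InducedModule H V) x w) = superAct W x (lift f hf w) := by
  rw [act_eq_mulLeft, lift_mulLeft, envAct_ι]

theorem parityOp_lift (hpar : ∀ v, f (parityOp V v) = parityOp W (f v))
    (w : InducedModule H V) : parityOp W (lift f hf w) = lift f hf (parity H V w) := by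
  induction w using induction_on with
  | tmul u v => rw [lift_mk, parity_mk, lift_mk, parityOp_envAct, hpar]
  | zero => simp
  | add w w' h h' => simp [h, h']

theorem lift_mem_gr (hpar : ∀ v, f (parityOp V v) = parityOp W (f v)) {a : ZMod 2}
    {w : InducedModule H V} (hw : w ∈ SuperSpace.gr (V := InducedModule H V) a) :
    lift f hf w ∈ SuperSpace.gr (V := W) a :=
  mem_gr_of_parityOp (by rw [parityOp_lift hf hpar, (mem_gr H V).1 hw, map_smul])

theorem mulLeft_one (w : InducedModule H V) : mulLeft H V 1 w = w := by
  induction w using induction_on with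
  | tmul u v => rw [mulLeft_mk, one_mul]
  | zero => simp
  | add w w' h h' => rw [map_add, h, h']

theorem mulLeft_mul (u u' : SuperEnveloping L) (w : InducedModule H V) :
    mulLeft H V (u * u') w = mulLeft H V u (mulLeft H V u' w) := by
  induction w using induction_on with
  | tmul u'' v => rw [mulLeft_mk, mulLeft_mk, mulLeft_mk, mul_assoc]
  | zero => simp
  | add w w' h h' => rw [map_add, map_add, map_add, h, h']

theorem mulLeft_mem {S : Submodule ℂ (InducedModule H V)}
    (hS : ∀ x : L, ∀ w ∈ S, superAct (InducedModule H V) x w ∈ S) (u : SuperEnveloping L)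
    {w : InducedModule H V} (hw : w ∈ S) : mulLeft H V u w ∈ S := by
  induction u using SuperEnveloping.induction generalizing w with
  | algebraMap c =>
    have : mulLeft H V (algebraMap ℂ _ c) w = c • w := by
      rw [Algebra.algebraMap_eq_smul_one, mulLeft_smul, LinearMap.smul_apply]
      rw [mulLeft_one]
    rw [this]
    exact Submodule.smul_mem _ _ hw
  | ι x => exact hS x w hw
  | mul u u' h h' =>
    rw [mulLeft_mul]
    exact h (h' hw)
  | add u u' h h' =>
    rw [mulLeft_add]
    exact add_mem (h hw) (h' hw)

/-- The embedding `v ↦ 1 ⊗ v` of `V` in the induced module. -/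
def incl (H : LieSubsuperalgebra L) (V : Type*) [AddCommGroup V] [Module ℂ V] [SuperSpace V]
    [LieSupermodule H.carrier V] : V →ₗ[ℂ] InducedModule H V :=
  mk H V ∘ₗ TensorProduct.mk ℂ (SuperEnveloping L) V 1

theorem lift_incl (v : V) : lift f hf (incl H V v) = f v := by
  rw [incl, LinearMap.comp_apply, TensorProduct.mk_apply, lift_mk, map_one, Module.End.one_apply]

theorem act_incl (h : H.carrier) (v : V) :
    superAct (InducedModule H V) (h : L) (incl H V v) = incl H V (superAct V h v) := by
  rw [act_eq_mulLeft, incl, LinearMap.comp_apply, LinearMap.comp_apply, TensorProduct.mk_apply,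
    TensorProduct.mk_apply, mulLeft_mk, mul_one, ← sub_eq_zero, ← map_sub]
  refine (Submodule.Quotient.mk_eq_zero _).2 (Submodule.subset_span ⟨1, h, v, ?_⟩)
  rw [one_mul]

theorem eq_top_of_incl_mem {S : Submodule ℂ (InducedModule H V)}
    (hS : ∀ x : L, ∀ w ∈ S, superAct (InducedModule H V) x w ∈ S)
    (h : LinearMap.range (incl H V) ≤ S) : S = ⊤ := by
  refine (Submodule.eq_top_iff').2 fun w => ?_
  induction w using induction_on with
  | tmul u v =>
    have h1 := mulLeft_mem hS u (h ⟨v, rfl⟩)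
    rwa [incl, LinearMap.comp_apply, TensorProduct.mk_apply, mulLeft_mk, mul_one] at h1
  | zero => exact zero_mem _
  | add w w' h h' => exact add_mem h h'

end InducedModule

/-! ## Graded subspaces as modules over a subalgebra -/

section Sub

variable {W : Type*} [AddCommGroup W] [Module ℂ W] [SuperSpace W]

/-- The grading of a graded subspace. -/
abbrev SuperSpace.ofSub (V : Submodule ℂ W) (hV : IsGradedSub V) : SuperSpace V where
  gr a := (SuperSpace.gr (V := W) a).comap V.subtype
  isCompl := by
    constructor
    · rw [Submodule.disjoint_def]
      intro v h0 h1
      exact Subtype.ext ((Submodule.disjoint_def.1 (SuperSpace.isCompl (V := W)).disjoint) _ h0 h1)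
    · rw [codisjoint_iff, eq_top_iff]
      rintro ⟨v, hv⟩ _
      obtain ⟨v₀, v₁, m₀, m₁, g₀, g₁, rfl⟩ := hV v hv
      exact Submodule.mem_sup.2 ⟨⟨v₀, m₀⟩, g₀, ⟨v₁, m₁⟩, g₁, rfl⟩

/-- A graded subspace that is stable under a subalgebra is a module over it. -/
abbrev LieSupermodule.ofSub [LieSupermodule L W] (H : LieSubsuperalgebra L)
    (V : Submodule ℂ W) (hV : IsGradedSub V)
    (hs : ∀ h : H.carrier, ∀ v ∈ V, superAct W (h : L) v ∈ V) :
    @LieSupermodule H.carrier _ _ _ V _ _ (SuperSpace.ofSub V hV) :=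
  letI := SuperSpace.ofSub V hV
  { act :=
      { toFun := fun h => (superAct W (h : L)).restrict (hs h)
        map_add' := fun h h' => LinearMap.ext fun v => Subtype.ext (by simp [superAct])
        map_smul' := fun c h => LinearMap.ext fun v => Subtype.ext (by simp [superAct]) }
    act_mem := fun hx hv => LieSupermodule.act_mem (L := L) (V := W) hx hv
    act_bracket := fun hx hy v =>
      Subtype.ext (LieSupermodule.act_bracket (L := L) (V := W) hx hy (v : W)) }

theorem parityOp_ofSub (V : Submodule ℂ W) (hV : IsGradedSub V) (v : V) :
    letI := SuperSpace.ofSub V hV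
    ((parityOp V v : V) : W) = parityOp W (v : W) := by
  let _ := SuperSpace.ofSub V hV
  obtain ⟨v₀, v₁, g₀, g₁, rfl⟩ := SuperSpace.exists_add v
  have e₀ : parityOp W (v₀ : W) = _ := parityOp_apply (a := 0) g₀
  have e₁ : parityOp W (v₁ : W) = _ := parityOp_apply (a := 1) g₁
  rw [map_add, parityOp_apply g₀, parityOp_apply g₁]
  simp only [Submodule.coe_add, Submodule.coe_smul, map_add]
  rw [e₀, e₁]

end Sub

/-- If a bijective even homomorphism maps onto a simple module, then its source is simple,
and isomorphic to the target. -/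
theorem simple_and_isomorphic_of_bijective
    {V : Type*} [AddCommGroup V] [Module ℂ V] [SuperSpace V] [LieSupermodule L V]
    {W : Type*} [AddCommGroup W] [Module ℂ W] [SuperSpace W] [LieSupermodule L W]
    (hW : IsSimpleSupermodule L W) (φ : V ≃ₗ[ℂ] W)
    (hgr : ∀ a : ZMod 2, ∀ v ∈ SuperSpace.gr (V := V) a, φ v ∈ SuperSpace.gr (V := W) a)
    (hact : ∀ (x : L) (v : V), φ (superAct V x v) = superAct W x (φ v)) :
    IsSimpleSupermodule L V ∧ SupermoduleIsomorphic L W V := by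
  refine ⟨⟨?_, fun N hN hs => ?_⟩, φ.symm, fun a w hw => ?_, fun x w => ?_⟩
  · have := hW.1
    exact φ.toEquiv.nontrivial
  · have h := hW.2 (N.map (φ : V →ₗ[ℂ] W)) ?_ ?_
    · rcases h with h | h
      · left
        rwa [Submodule.map_eq_bot_iff] at h
      · right
        rw [Submodule.eq_top_iff']
        intro v
        obtain ⟨v', hv', e⟩ := (h ▸ Submodule.mem_top : φ v ∈ N.map (φ : V →ₗ[ℂ] W))
        rwa [← φ.injective e]
    · rintro _ ⟨v, hv, rfl⟩
      obtain ⟨v₀, v₁, m₀, m₁, g₀, g₁, rfl⟩ := hN v hv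
      exact ⟨φ v₀, φ v₁, ⟨v₀, m₀, rfl⟩, ⟨v₁, m₁, rfl⟩, hgr _ _ g₀, hgr _ _ g₁, map_add φ _ _⟩
    · rintro x _ ⟨v, hv, rfl⟩
      exact ⟨superAct V x v, hs x v hv, hact x v⟩
  · have hpar : ∀ v, φ (parityOp V v) = parityOp W (φ v) := by
      intro v
      obtain ⟨v₀, v₁, g₀, g₁, rfl⟩ := SuperSpace.exists_add v
      simp only [map_add, parityOp_apply g₀, parityOp_apply g₁, map_smul,
        parityOp_apply (hgr _ _ g₀), parityOp_apply (hgr _ _ g₁)]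
    refine mem_gr_of_parityOp (φ.injective ?_)
    rw [hpar, map_smul, φ.apply_symm_apply, parityOp_apply hw]
  · apply φ.injective
    rw [hact]
    simp

end InducedHoms

namespace BMS

theorem mem_of_forall_e {X : Type*} [AddCommGroup X] [Module ℂ X] [SuperSpace X]
    [LieSupermodule BMS X] {S : Submodule ℂ X} {u : X} (h : ∀ i, superAct X (e i) u ∈ S)
    (x : BMS) : superAct X x u ∈ S := by
  induction x using Finsupp.induction_linear with
  | zero => simp [superAct]
  | add x y hx hy =>
    rw [superAct, map_add]
    exact add_mem hx hy
  | single i c =>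
    have : Finsupp.single i c = c • e i := by simp [e]
    rw [this, superAct, map_smul]
    exact Submodule.smul_mem _ _ (h i)

/-! ### Comparison of the induced module with a simple module -/

section Induction

variable {q t : ℕ}
  {V : Type*} [AddCommGroup V] [Module ℂ V] [SuperSpace V] [LieSupermodule (sub q).carrier V]
  {W : Type*} [AddCommGroup W] [Module ℂ W] [SuperSpace W] [LieSupermodule BMS W]
  {f : V →ₗ[ℂ] W}

/-- Each annihilator belongs to `𝔤^{(0,-q)}`, so that it kills `V` can be checked in `W`, where `V`
embeds. Generation holds because `𝔤` generates its enveloping algebra. -/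
theorem isVacuum_range_incl (hinj : Function.Injective f)
    (hf : ∀ (h : (sub q).carrier) (v : V), f (superAct V h v) = superAct W (h : BMS) (f v))
    (hM : ∀ i : ℤ, t < i → ∀ v, superAct W (M i) (f v) = 0)
    (hQ : ∀ i : ℤ, t < i → ∀ v, superAct W (Q i) (f v) = 0)
    (hL : ∀ i : ℤ, t + q < i → ∀ v, superAct W (L i) (f v) = 0) :
    IsVacuum q t (LinearMap.range (InducedModule.incl (sub q) V)) := by
  have key : ∀ i (hi : i ∈ subIndex q), ∀ u ∈ LinearMap.range (InducedModule.incl (sub q) V),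
      (∀ v, superAct W (e i) (f v) = 0) → superAct (Ind q V) (e i) u = 0 := by
    rintro i hi _ ⟨v, rfl⟩ h
    have h1 : superAct V (⟨e i, e_mem hi⟩ : (sub q).carrier) v = 0 :=
      hinj (by rw [hf, map_zero]; exact h v)
    have h2 := InducedModule.act_incl (H := sub q) ⟨e i, e_mem hi⟩ v
    rw [h1, map_zero] at h2
    exact h2
  refine ⟨?_, fun i hi u hu => ?_, fun i hi u hu => ?_, fun i hi u hu => ?_, ?_⟩
  · rintro i hi _ ⟨v, rfl⟩
    exact ⟨_, (InducedModule.act_incl (H := sub q) ⟨e i, e_mem hi⟩ v).symm⟩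
  · exact key (.M i) (by simp only [subIndex, Set.mem_ofPred_eq]; omega) u hu (hM i hi)
  · exact key (.Q i) (by simp only [subIndex, Set.mem_ofPred_eq]; omega) u hu (hQ i hi)
  · exact key (.L i) (by simp only [subIndex, Set.mem_ofPred_eq]; omega) u hu (hL i hi)
  · exact fun S hS h => InducedModule.eq_top_of_incl_mem
      (fun x w hw => mem_of_forall_e (fun i => h i w hw) x) hS

/-- Let `V` be embedded in a simple `𝔤`-module `W` on which `M_t` is suitably nondegenerate, as a
nonzero subspace that is annihilated by the `M_i`, `Q_i` with `i > t` and the `L_i` with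
`i > t + q`. Then `Ind V ≅ W`, and all vectors that are annihilated by these operators lie in `V`. -/
theorem bijective_lift [Nontrivial V] (hW : IsSimpleSupermodule BMS W)
    (hinj : Function.Injective f)
    (hf : ∀ (h : (sub q).carrier) (v : V), f (superAct V h v) = superAct W (h : BMS) (f v))
    (hpar : ∀ v, f (parityOp V v) = parityOp W (f v))
    (hM : ∀ i : ℤ, t < i → ∀ v, superAct W (M i) (f v) = 0)
    (hQ : ∀ i : ℤ, t < i → ∀ v, superAct W (Q i) (f v) = 0)
    (hL : ∀ i : ℤ, t + q < i → ∀ v, superAct W (L i) (f v) = 0)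
    (hnd : IsNondegenerateMod t (⊥ : Submodule ℂ W)) :
    Function.Bijective (InducedModule.lift f hf) ∧
      ∀ w : W, (∀ i : ℤ, t < i → superAct W (M i) w = 0) →
        (∀ i : ℤ, t < i → superAct W (Q i) w = 0) →
        (∀ i : ℤ, t + q < i → superAct W (L i) w = 0) → w ∈ LinearMap.range f := by
  have hvac := isVacuum_range_incl hinj hf hM hQ hL
  -- Nondegeneracy on `W` pulls back to nondegeneracy modulo the kernel; nothing is known yet about
  -- `M_t` on the induced module itself.
  have hK : IsNondegenerateMod t (LinearMap.ker (InducedModule.lift f hf)) := by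
    refine ⟨fun i u hu => ?_, fun n hn u hu h => ?_⟩
    · rw [LinearMap.mem_ker] at hu ⊢
      rw [InducedModule.lift_act, hu, map_zero]
    · refine LinearMap.mem_ker.2 ((Submodule.mem_bot ℂ).1 (hnd.nondeg n hn _ (fun i hi => ?_) ?_))
      · have := hu i hi
        rwa [LinearMap.mem_ker, InducedModule.lift_act] at this
      · rwa [LinearMap.mem_ker, map_add, map_smul, InducedModule.lift_act,
          InducedModule.lift_act] at h
  have hbot := hvac.eq_bot hK (by
    rintro _ ⟨v, rfl⟩ hv
    rw [LinearMap.mem_ker, InducedModule.lift_incl] at hv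
    rw [hinj (hv.trans (map_zero f).symm), map_zero])
  have hker := LinearMap.ker_eq_bot.1 hbot
  have hsurj : LinearMap.range (InducedModule.lift f hf) = ⊤ := by
    refine (hW.2 _ ?_ ?_).resolve_left fun h => ?_
    · rintro _ ⟨u, rfl⟩
      obtain ⟨u₀, u₁, g₀, g₁, rfl⟩ := SuperSpace.exists_add u
      exact ⟨_, _, ⟨u₀, rfl⟩, ⟨u₁, rfl⟩, InducedModule.lift_mem_gr hf hpar g₀,
        InducedModule.lift_mem_gr hf hpar g₁, map_add _ _ _⟩
    · rintro x _ ⟨u, rfl⟩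
      exact ⟨_, InducedModule.lift_act hf x u⟩
    · obtain ⟨v, hv⟩ := exists_ne (0 : V)
      refine hv (hinj ?_)
      have h1 : InducedModule.lift f hf (InducedModule.incl (sub q) V v) ∈
        LinearMap.range (InducedModule.lift f hf) := ⟨_, rfl⟩
      rw [h, InducedModule.lift_incl] at h1
      rw [(Submodule.mem_bot ℂ).1 h1, map_zero]
  refine ⟨⟨hker, LinearMap.range_eq_top.1 hsurj⟩, fun w h1 h2 h3 => ?_⟩
  obtain ⟨u, rfl⟩ := LinearMap.range_eq_top.1 hsurj w
  have h0 : ∀ x : BMS, superAct W x (InducedModule.lift f hf u) = 0 →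
      superAct (Ind q V) x u = 0 := fun x hx => hker (by
    rw [InducedModule.lift_act, hx, map_zero])
  -- As the kernel vanishes, the induced module itself is nondegenerate, and its vacuum vectors can
  -- be located.
  rw [hbot] at hK
  obtain ⟨v, rfl⟩ := hvac.mem_of_annihilated hK (fun i hi => h0 _ (h1 i hi))
    (fun i hi => h0 _ (h2 i hi)) (fun i hi => h0 _ (h3 i hi))
  exact ⟨v, (InducedModule.lift_incl hf v).symm⟩

end Induction

/-! ### The vacuum space of a smooth module -/

section Vacuum

variable {W : Type*} [AddCommGroup W] [Module ℂ W] [SuperSpace W] [LieSupermodule BMS W]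

noncomputable section

/-- The vectors that are annihilated by the `M_i`, `Q_{i-1/2}` with `i > t` and by the `L_i` with
`i > t + q`. -/
def vacuum (W : Type*) [AddCommGroup W] [Module ℂ W] [SuperSpace W] [LieSupermodule BMS W]
    (q t : ℕ) : Submodule ℂ W where
  carrier := {w | (∀ i : ℤ, t < i → superAct W (M i) w = 0) ∧
    (∀ i : ℤ, t < i → superAct W (Q i) w = 0) ∧ ∀ i : ℤ, t + q < i → superAct W (L i) w = 0}
  add_mem' := fun ⟨h1, h2, h3⟩ ⟨h1', h2', h3'⟩ => by
    refine ⟨fun i hi => ?_, fun i hi => ?_, fun i hi => ?_⟩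
    · rw [map_add, h1 i hi, h1' i hi, add_zero]
    · rw [map_add, h2 i hi, h2' i hi, add_zero]
    · rw [map_add, h3 i hi, h3' i hi, add_zero]
  zero_mem' := by simp
  smul_mem' := fun c w ⟨h1, h2, h3⟩ => by
    refine ⟨fun i hi => ?_, fun i hi => ?_, fun i hi => ?_⟩
    · rw [map_smul, h1 i hi, smul_zero]
    · rw [map_smul, h2 i hi, smul_zero]
    · rw [map_smul, h3 i hi, smul_zero]

end

theorem act_components_eq_zero (i : BMSIndex) {w₀ w₁ : W}
    (h₀ : w₀ ∈ SuperSpace.gr (V := W) 0) (h₁ : w₁ ∈ SuperSpace.gr (V := W) 1)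
    (h : superAct W (e i) (w₀ + w₁) = 0) :
    superAct W (e i) w₀ = 0 ∧ superAct W (e i) w₁ = 0 := by
  have g₀ := LieSupermodule.act_mem (L := BMS) (V := W) (e_mem (s := {k | par k = par i}) rfl) h₀
  have g₁ := LieSupermodule.act_mem (L := BMS) (V := W) (e_mem (s := {k | par k = par i}) rfl) h₁
  have hd := Submodule.disjoint_def.1 (SuperSpace.isCompl (V := W)).disjoint
  rw [map_add] at h
  have hz : superAct W (e i) w₀ = 0 := by
    have hneg : superAct W (e i) w₀ = -superAct W (e i) w₁ := eq_neg_of_add_eq_zero_left h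
    rcases zmod2_cases (par i) with hp | hp
    · rw [hp, add_zero] at g₀
      rw [hp, zero_add] at g₁
      refine hd _ g₀ ?_
      rw [hneg]
      exact neg_mem g₁
    · rw [hp, add_zero] at g₀
      rw [hp, show (1 + 1 : ZMod 2) = 0 by decide] at g₁
      refine hd _ ?_ g₀
      rw [hneg]
      exact neg_mem g₁
  rw [hz, zero_add] at h
  exact ⟨hz, h⟩

theorem vacuum_graded (q t : ℕ) : IsGradedSub (vacuum W q t) := by
  rintro v ⟨h1, h2, h3⟩
  obtain ⟨v₀, v₁, g₀, g₁, rfl⟩ := SuperSpace.exists_add v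
  exact ⟨v₀, v₁,
    ⟨fun i hi => (act_components_eq_zero _ g₀ g₁ (h1 i hi)).1,
      fun i hi => (act_components_eq_zero _ g₀ g₁ (h2 i hi)).1,
      fun i hi => (act_components_eq_zero _ g₀ g₁ (h3 i hi)).1⟩,
    ⟨fun i hi => (act_components_eq_zero _ g₀ g₁ (h1 i hi)).2,
      fun i hi => (act_components_eq_zero _ g₀ g₁ (h2 i hi)).2,
      fun i hi => (act_components_eq_zero _ g₀ g₁ (h3 i hi)).2⟩, g₀, g₁, rfl⟩

/-- Brackets with `𝔤^{(0,-q)}` keep the annihilators above their thresholds. Only `[L_i, M_a]` with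
`a ≥ -q` can lower an index, by at most `q`, which is why the bound for `L_i` is `t + q`. The
resulting indices are positive, so no central terms occur. -/
theorem e_vacuum_mem {q t : ℕ} {i : BMSIndex} (hi : i ∈ subIndex q) {w : W}
    (hw : w ∈ vacuum W q t) : superAct W (e i) w ∈ vacuum W q t := by
  obtain ⟨h1, h2, h3⟩ := hw
  rcases i with a | a | a | _ | _ <;> simp only [subIndex, Set.mem_ofPred_eq] at hi
  · refine ⟨fun i hi' => ?_, fun i hi' => ?_, fun i hi' => ?_⟩
    · refine (act_M_L i a w).trans ?_
      rw [h1 i hi', h1 (a + i) (by omega), if_neg (by omega)]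
      simp
    · refine (act_Q_L i a w).trans ?_
      rw [h2 i hi', h2 (a + i) (by omega)]
      simp
    · refine (act_L_L i a w).trans ?_
      rw [h3 i hi', h3 (i + a) (by omega), if_neg (by omega)]
      simp
  · refine ⟨fun i hi' => ?_, fun i hi' => ?_, fun i hi' => ?_⟩
    · refine (act_M_M i a w).trans ?_
      rw [h1 i hi', map_zero]
    · refine (act_M_Q a i w).symm.trans ?_
      rw [h2 i hi', map_zero]
    · refine (act_L_M i a w).trans ?_
      rw [h3 i hi', h1 (i + a) (by omega), if_neg (by omega)]
      simp
  · refine ⟨fun i hi' => ?_, fun i hi' => ?_, fun i hi' => ?_⟩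
    · refine (act_M_Q i a w).trans ?_
      rw [h1 i hi', map_zero]
    · refine (act_Q_Q i a w).trans ?_
      rw [h2 i hi', h1 (i + a - 1) (by omega), if_neg (by omega)]
      simp
    · refine (act_L_Q i a w).trans ?_
      rw [h3 i hi', h2 (i + a) (by omega)]
      simp
  · refine ⟨fun i hi' => ?_, fun i hi' => ?_, fun i hi' => ?_⟩
    · exact (act_c₁ (.M i) w).symm.trans ((congrArg _ (h1 i hi')).trans (map_zero _))
    · exact (act_c₁ (.Q i) w).symm.trans ((congrArg _ (h2 i hi')).trans (map_zero _))
    · exact (act_c₁ (.L i) w).symm.trans ((congrArg _ (h3 i hi')).trans (map_zero _))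
  · refine ⟨fun i hi' => ?_, fun i hi' => ?_, fun i hi' => ?_⟩
    · exact (act_c₂ (.M i) w).symm.trans ((congrArg _ (h1 i hi')).trans (map_zero _))
    · exact (act_c₂ (.Q i) w).symm.trans ((congrArg _ (h2 i hi')).trans (map_zero _))
    · exact (act_c₂ (.L i) w).symm.trans ((congrArg _ (h3 i hi')).trans (map_zero _))

theorem act_vacuum_mem (q t : ℕ) (h : (sub q).carrier) (w : W) (hw : w ∈ vacuum W q t) :
    superAct W (h : BMS) w ∈ vacuum W q t := by
  refine spanOf_induction (p := fun x => superAct W x w ∈ vacuum W q t) h.2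
    (fun i hi => e_vacuum_mem hi hw) (by simp [superAct]) (fun x y hx hy => ?_)
    fun c x hx => ?_
  · rw [superAct, map_add]
    exact add_mem hx hy
  · rw [superAct, map_smul]
    exact Submodule.smul_mem _ _ hx

/-- A smooth module has a nonzero vacuum space for large `q`, as soon as it has a nonzero vector
that is annihilated by the `M_i` with `i > t`. -/
theorem exists_mem_vacuum (hsmooth : IsSmooth W) {t : ℕ} {w : W} (hw : w ≠ 0)
    (hM : ∀ i : ℤ, t < i → superAct W (M i) w = 0) : ∃ q, ∃ v ∈ vacuum W q t, v ≠ 0 := by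
  have key : ∀ n : ℕ, ∀ w : W, w ≠ 0 → (∀ i : ℤ, t < i → superAct W (M i) w = 0) →
      (∀ i : ℤ, t + n < i → superAct W (Q i) w = 0) →
      ∃ v : W, v ≠ 0 ∧ (∀ i : ℤ, t < i → superAct W (M i) v = 0) ∧
        ∀ i : ℤ, t < i → superAct W (Q i) v = 0 := by
    intro n
    induction n with
    | zero => exact fun w hw h1 h2 => ⟨w, hw, h1, fun i hi => h2 i (by omega)⟩
    | succ n ih =>
      intro w hw h1 h2
      by_cases h : superAct W (Q (t + n + 1)) w = 0
      · refine ih w hw h1 fun i hi => ?_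
        rcases eq_or_ne i (t + n + 1) with rfl | hne
        · exact h
        · exact h2 i (by omega)
      -- If the highest remaining `Q` does not kill `w`, then `w` is replaced by its image. Its
      -- anticommutators with itself and with the higher `Q`s are multiples of some `M_k` with `k >
      -- t`, so they vanish on `w`; in particular twice its square does.
      · refine ih _ h (fun i hi => by rw [act_M_Q, h1 i hi, map_zero]) fun i hi => ?_
        have h0 : superAct W (Q i) w = 0 ∨ i = t + n + 1 := by
          rcases eq_or_ne i (t + n + 1) with rfl | hne
          · exact Or.inr rfl
          · exact Or.inl (h2 i (by omega))
        have hrel := act_Q_Q (X := W) i (t + n + 1) w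
        rw [h1 _ (by omega), if_neg (by omega), smul_zero, zero_smul, add_zero, add_zero] at hrel
        rcases h0 with h0 | rfl
        · rw [hrel, h0, map_zero, smul_zero]
        · refine (smul_eq_zero_iff_right (two_ne_zero (α := ℂ))).1 ?_
          rw [two_smul]
          nth_rewrite 1 [hrel]
          rw [neg_one_smul, neg_add_cancel]
  obtain ⟨N, hN⟩ := hsmooth w
  obtain ⟨v, hv, h1, h2⟩ := key N.toNat w hw hM fun i hi => (hN i (by omega)).2.2
  obtain ⟨N', hN'⟩ := hsmooth v
  -- Any `q` past the smoothness bound of `v` for the `L_i` will do.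
  exact ⟨N'.toNat, v, ⟨h1, h2, fun i hi => (hN' i (by omega)).1⟩, hv⟩

/-- The smallest `t` such that some nonzero vector is annihilated by the `M_i` with `i > t`. -/
theorem exists_isNondegenerateMod [Nontrivial W] (hsmooth : IsSmooth W)
    (hinj : ∀ n : ℤ, n ≠ 0 → Function.Injective
      (superAct W (M 0 + ((1 / 24 : ℂ) * ((n : ℂ) ^ 2 - 1)) • c₂))) :
    ∃ t : ℕ, IsNondegenerateMod t (⊥ : Submodule ℂ W) ∧
      ∃ w : W, w ≠ 0 ∧ ∀ i : ℤ, t < i → superAct W (M i) w = 0 := by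
  classical
  have hex : ∃ t : ℕ, ∃ w : W, w ≠ 0 ∧ ∀ i : ℤ, t < i → superAct W (M i) w = 0 := by
    obtain ⟨w, hw⟩ := exists_ne (0 : W)
    obtain ⟨N, hN⟩ := hsmooth w
    exact ⟨N.toNat, w, hw, fun i hi => (hN i (by omega)).2.1⟩
  refine ⟨Nat.find hex, ⟨fun i u hu => by simp [(Submodule.mem_bot ℂ).1 hu], ?_⟩,
    Nat.find_spec hex⟩
  intro n hn u hu h
  simp only [Submodule.mem_bot] at hu h ⊢
  by_cases ht : Nat.find hex = 0
  · rw [ht] at h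
    refine hinj n hn ?_
    rw [map_zero, superAct, map_add, map_smul]
    simpa using h
  · rw [if_neg ht, zero_smul, add_zero] at h
    by_contra hne
    -- A nonzero `u` that is also killed by `M_t` would contradict the minimality of `t`.
    refine Nat.find_min hex (m := Nat.find hex - 1) (by omega) ⟨u, hne, fun i hi => ?_⟩
    rcases eq_or_ne i (Nat.find hex) with rfl | hi'
    · exact h
    · exact hu i (by omega)

/-- A nonzero vacuum space is a simple module that induces the given simple module. -/
theorem vacuum_simple_and_induces (hW : IsSimpleSupermodule BMS W) {q t : ℕ}
    (hnd : IsNondegenerateMod t (⊥ : Submodule ℂ W)) (hne : ∃ v ∈ vacuum W q t, v ≠ 0) :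
    letI := SuperSpace.ofSub (vacuum W q t) (vacuum_graded q t)
    letI := LieSupermodule.ofSub (sub q) (vacuum W q t) (vacuum_graded q t) (act_vacuum_mem q t)
    IsSimpleSupermodule (sub q).carrier (vacuum W q t) ∧
      IsSimpleSupermodule BMS (Ind q (vacuum W q t)) ∧
      SupermoduleIsomorphic BMS W (Ind q (vacuum W q t)) := by
  -- Stated for every `N` in the vacuum space: its second half yields the simplicity of the vacuum
  -- space, its first half with `N` the whole vacuum space yields the isomorphism.
  have key : ∀ (N : Submodule ℂ W) (hN : IsGradedSub N)
      (hs : ∀ h : (sub q).carrier, ∀ v ∈ N, superAct W (h : BMS) v ∈ N),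
      N ≤ vacuum W q t → N ≠ ⊥ →
      letI := SuperSpace.ofSub N hN
      letI := LieSupermodule.ofSub (sub q) N hN hs
      Function.Bijective (InducedModule.lift (L := BMS) (H := sub q) N.subtype
        (fun _ _ => rfl)) ∧ vacuum W q t ≤ N := by
    intro N hN hs hle hbot
    let _ := SuperSpace.ofSub N hN
    let _ := LieSupermodule.ofSub (sub q) N hN hs
    have : Nontrivial N := Submodule.nontrivial_iff_ne_bot.2 hbot
    obtain ⟨h1, h2⟩ := bijective_lift (q := q) (t := t) (f := N.subtype) hW N.injective_subtype
      (fun _ _ => rfl) (parityOp_ofSub N hN) (fun i hi v => (hle v.2).1 i hi)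
      (fun i hi v => (hle v.2).2.1 i hi) (fun i hi v => (hle v.2).2.2 i hi) hnd
    refine ⟨h1, fun w hw => ?_⟩
    obtain ⟨v, rfl⟩ := h2 w hw.1 hw.2.1 hw.2.2
    exact v.2
  have hVbot : vacuum W q t ≠ ⊥ := by
    obtain ⟨v, hv, h0⟩ := hne
    exact (Submodule.ne_bot_iff _).2 ⟨v, hv, h0⟩
  let _ := SuperSpace.ofSub (vacuum W q t) (vacuum_graded q t)
  let _ := LieSupermodule.ofSub (sub q) (vacuum W q t) (vacuum_graded q t) (act_vacuum_mem q t)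
  refine ⟨⟨Submodule.nontrivial_iff_ne_bot.2 hVbot, fun N hN hs => ?_⟩, ?_⟩
  · rw [or_iff_not_imp_left]
    intro hbot
    have h := (key (N.map (vacuum W q t).subtype) ?_ ?_ ?_ ?_).2
    · rw [Submodule.eq_top_iff']
      intro v
      obtain ⟨v', hv', hvv⟩ := h v.2
      rwa [← Subtype.ext hvv]
    · rintro _ ⟨v, hv, rfl⟩
      obtain ⟨v₀, v₁, m₀, m₁, g₀, g₁, rfl⟩ := hN v hv
      exact ⟨_, _, ⟨v₀, m₀, rfl⟩, ⟨v₁, m₁, rfl⟩, g₀, g₁, rfl⟩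
    · rintro h _ ⟨v, hv, rfl⟩
      exact ⟨superAct (vacuum W q t) h v, hs h v hv, rfl⟩
    · rintro _ ⟨v, _, rfl⟩
      exact v.2
    · intro h
      exact hbot (Submodule.map_injective_of_injective (vacuum W q t).injective_subtype
        (h.trans (Submodule.map_bot _).symm))
  · have hbij := (key _ (vacuum_graded q t) (act_vacuum_mem q t) le_rfl hVbot).1
    refine simple_and_isomorphic_of_bijective hW (LinearEquiv.ofBijective _ hbij) ?_
      (fun x v => InducedModule.lift_act (f := (vacuum W q t).subtype) (fun _ _ => rfl) x v)
    exact fun a v hv => InducedModule.lift_mem_gr (f := (vacuum W q t).subtype) (fun _ _ => rfl)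
      (parityOp_ofSub _ (vacuum_graded q t)) hv

end Vacuum

end BMS

/-! ### The main theorem -/

theorem theorem4p5 (c₁ c₂ : ℂ)
    (W : Type u) [AddCommGroup W] [Module ℂ W] [SuperSpace W] [LieSupermodule BMS W]
    (hsimple : IsSimpleSupermodule BMS W)
    (hsmooth : BMS.IsSmooth W)
    (hcharge : BMS.HasCentralCharge W c₁ c₂)
    (hinj : ∀ n : ℤ, n ≠ 0 → Function.Injective
      (superAct W (BMS.M 0 + ((1 / 24 : ℂ) * ((n : ℂ) ^ 2 - 1)) • BMS.c₂))) :
    ∃ (q : ℕ) (V : Type u) (_ : AddCommGroup V) (_ : Module ℂ V) (_ : SuperSpace V)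
      (_ : LieSupermodule (BMS.sub q).carrier V),
      IsSimpleSupermodule (BMS.sub q).carrier V ∧
      BMS.HasCentralChargeSub q V c₁ c₂ ∧
      (∃ t : ℕ, BMS.ConditionA q V t ∧ BMS.ConditionB q V t) ∧
      IsSimpleSupermodule BMS (BMS.Ind q V) ∧
      SupermoduleIsomorphic BMS W (BMS.Ind q V) := by
  have := hsimple.1
  obtain ⟨t, hnd, w, hw, hM⟩ := BMS.exists_isNondegenerateMod hsmooth hinj
  obtain ⟨q, hne⟩ := BMS.exists_mem_vacuum hsmooth hw hM
  obtain ⟨h1, h2, h3⟩ := BMS.vacuum_simple_and_induces hsimple hnd hne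
  refine ⟨q, BMS.vacuum W q t, inferInstance, inferInstance,
    SuperSpace.ofSub _ (BMS.vacuum_graded q t),
    LieSupermodule.ofSub (BMS.sub q) _ (BMS.vacuum_graded q t) (BMS.act_vacuum_mem q t),
    h1, fun v => ⟨Subtype.ext (hcharge v).1, Subtype.ext (hcharge v).2⟩,
    ⟨t, ⟨fun ht => ?_, ?_⟩, fun i hi v => ?_, fun j hj v => ?_⟩, h2, h3⟩
  · refine (injective_iff_map_eq_zero _).2 fun v hv => Subtype.ext ?_
    -- For `t > 0` the central term is absent, so any nonzero integer serves; `1` is arbitrary.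
    refine (Submodule.mem_bot ℂ).1 (hnd.nondeg 1 one_ne_zero _
      (fun i hi => (Submodule.mem_bot ℂ).2 (v.2.1 i hi)) ?_)
    rw [if_neg ht.ne', zero_smul, add_zero]
    exact (Submodule.mem_bot ℂ).2 (congrArg Subtype.val hv)
  · rintro rfl n hn v v' hv
    exact Subtype.ext (hinj n hn (congrArg Subtype.val hv))
  · exact Subtype.ext (v.2.1 i (by omega))
  · exact Subtype.ext (v.2.2.2 j (by omega))
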